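/- **The multivariate skew-slash distribution.** Let $q>0$, let $U\sim\mathrm{Uniform}(0,1)$ and $S=U^{-1/q}$. Let $\xi\in\mathbb R^p$, let $\Omega$ be a symmetric positive definite $p\times p$ matrix, $\omega=\mathrm{diag}(\sqrt{\Omega_{11}},\dots,\sqrt{\Omega_{pp}})$, $\bar\Omega=\omega^{-1}\Omega\omega^{-1}$, $\alpha\in\mathbb R^p$ and $\eta=\omega^{-1}\alpha$. Let $X\sim SSL_p(\xi,\Omega,\alpha,q)$, that is, $X$ has the law of $\xi+\omega SZ$, where $Z$ is independent of $S$ and has Lebesgue density $2\,\phi_p(z;\bar\Omega)\,\Phi(\alpha'z)$ on $\mathbb R^p$; here $\phi_p(\cdot;\bar\Omega)$ is the density of $N_p(0,\bar\Omega)$ and $\Phi$ is the standard normal distribution function. 1. For every integer $m\ge 0$ with $m<q$, $S^m$ is integrable and $E(S^m)=\dfrac{q}{q-m}$. 2. If $q>3$, then $\dfrac{E(S^2)}{E(S)^2}=\dfrac{(q-1)^2}{q(q-2)}$, and this ratio is $\le \dfrac4\pi$ if and only if $q\ge 1+\dfrac{2}{\sqrt{4-\pi}}\ (\approx 3.16)$.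 In particular, the moment condition $\frac4\pi E(S)^2\ge E(S^2)$ holds for all $q\ge 4$. 3. If $q>3$, then the components of $X$ have finite third absolute moments. If moreover $\alpha\ne 0$, let $\Sigma$ be the covariance matrix of $X$ and, for a scalar random variable $Y$ with mean $\mu_Y$ and standard deviation $\sigma_Y>0$, let $\gamma_1(Y)=\bigl(E[((Y-\mu_Y)/\sigma_Y)^3]\bigr)^2$. Then $\eta'\Sigma\eta>0$, and the maximal-skewness direction of $X$ is $\eta$: the maximizers of $d\mapsto\gamma_1(d'X)$ over $\{d\in\mathbb R^p: d'\Sigma d=1\}$ are exactly those $d$ in this set that are proportional to $\eta$. (This holds for every $q>3$, including the values for which the moment condition in 2 fails.) -/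

import Mathlib

open MeasureTheory ProbabilityTheory
open scoped Matrix

namespace SkewSlash

noncomputable section

/-- The scale matrix `ω = diag(√Ω₁₁, …, √Ωₚₚ)` of a positive definite matrix `Ω`. -/
def scale {p : ℕ} (Ω : Matrix (Fin p) (Fin p) ℝ) : Matrix (Fin p) (Fin p) ℝ :=
  Matrix.diagonal fun i => √(Ω i i)

/-- The correlation matrix `ω⁻¹ Ω ω⁻¹` associated with `Ω`. -/
def corr {p : ℕ} (Ω : Matrix (Fin p) (Fin p) ℝ) : Matrix (Fin p) (Fin p) ℝ :=
  (scale Ω)⁻¹ * Ω * (scale Ω)⁻¹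

/-- The shape vector `η = ω⁻¹ α`. -/
def shape {p : ℕ} (Ω : Matrix (Fin p) (Fin p) ℝ) (α : Fin p → ℝ) : Fin p → ℝ :=
  (scale Ω)⁻¹ *ᵥ α

/-- The density at `z` of the centred `p`-dimensional normal law with covariance matrix `C`. -/
def normalDensity {p : ℕ} (C : Matrix (Fin p) (Fin p) ℝ) (z : Fin p → ℝ) : ℝ :=
  (√((2 * Real.pi) ^ p * C.det))⁻¹ * Real.exp (-(z ⬝ᵥ C⁻¹ *ᵥ z) / 2)

/-- The normalized skew-normal law `SN_p(0, C, α)` for a correlation matrix `C`: its Lebesgue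
density is `z ↦ 2 φ_p(z; C) Φ(α'z)`, with `Φ` the standard normal distribution function. -/
def skewNormal {p : ℕ} (C : Matrix (Fin p) (Fin p) ℝ) (α : Fin p → ℝ) : Measure (Fin p → ℝ) :=
  volume.withDensity fun z =>
    ENNReal.ofReal (2 * normalDensity C z * cdf (gaussianReal 0 1) (α ⬝ᵥ z))

/-- The scale mixture of skew-normal laws `SMSN_p(ξ, Ω, α, H)`: the law of `ξ + ω S Z`, where
`S` has law `H`, `Z` has the law `SN_p(0, ω⁻¹ Ω ω⁻¹, α)`, and `S` and `Z` are independent. -/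
def smsn {p : ℕ} (ξ : Fin p → ℝ) (Ω : Matrix (Fin p) (Fin p) ℝ) (α : Fin p → ℝ)
    (H : Measure ℝ) : Measure (Fin p → ℝ) :=
  (H.prod (skewNormal (corr Ω) α)).map fun sz => ξ + scale Ω *ᵥ (sz.1 • sz.2)

/-- The uniform law on the interval `(0, 1)`. -/
def uniform01 : Measure ℝ := volume.restrict (Set.Ioo 0 1)

/-- The skew-slash law `SSL_p(ξ, Ω, α, q)`: the scale mixture whose mixing variable is
`S = U ^ (-1 / q)` with `U` uniform on `(0, 1)`. -/
def skewSlash {p : ℕ} (ξ : Fin p → ℝ) (Ω : Matrix (Fin p) (Fin p) ℝ) (α : Fin p → ℝ)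
    (q : ℝ) : Measure (Fin p → ℝ) :=
  smsn ξ Ω α (uniform01.map fun u => u ^ (-1 / q))

/-- The covariance matrix of a random vector. -/
def covMatrix {S : Type*} [MeasurableSpace S] {p : ℕ} (X : S → Fin p → ℝ) (P : Measure S) :
    Matrix (Fin p) (Fin p) ℝ :=
  Matrix.of fun i j => cov[fun s => X s i, fun s => X s j; P]

/-- The skewness index `γ₁(Y) = (E[((Y - μ_Y) / σ_Y)³])²` of a random variable. -/
def skewness {S : Type*} [MeasurableSpace S] (Y : S → ℝ) (P : Measure S) : ℝ :=
  (∫ s, ((Y s - ∫ t, Y t ∂P) / √(Var[Y; P])) ^ 3 ∂P) ^ 2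

/-- The directions `d` with `d' Σ d = 1`, where `Σ` is the covariance matrix of `X`. -/
def unitDirections {S : Type*} [MeasurableSpace S] {p : ℕ} (X : S → Fin p → ℝ)
    (P : Measure S) : Set (Fin p → ℝ) :=
  {d | d ⬝ᵥ covMatrix X P *ᵥ d = 1}

/-- The set of all maximizers `arg max γ₁(d'X)` over the directions `d` with `d' Σ d = 1`. -/
def maxSkewnessDirections {S : Type*} [MeasurableSpace S] {p : ℕ} (X : S → Fin p → ℝ)
    (P : Measure S) : Set (Fin p → ℝ) :=
  {d | d ∈ unitDirections X P ∧
    IsMaxOn (fun e : Fin p → ℝ => skewness (fun s => e ⬝ᵥ X s) P) (unitDirections X P) d}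

end

end SkewSlash

namespace SkewSlash

/-! The moments of `S` are integrals of powers of `u` over (0,1), and part 2 is algebra in `q`. For
part 3 put a = ωd, so that d'X = d'ξ + S(a'Z). Writing C = BᵀB makes Z a linear image of a standard
normal vector reweighted by 2Φ, and `integral_dotProduct_skewNormal` gives the moments of a'Z as b
t, K and b(3Kt - t³), where K = a'Ca, b = √(2/π), t = a'Cα/√(1+v), v = α'Cα.

Let s_k = E(S^k). Unit variance reads s₂K - (s₁bt)² = 1. Eliminating K turns the third central
moment into a cubic At + Bt³, so the skewness depends on d only through t. The Cauchy–Schwarz defect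
D = K - (a'Cα)²/v ≥ 0, which vanishes exactly when d is proportional to η, puts the variance in the
form κt² + s₂D. Hence κt² ≤ 1 on the constraint set, with equality exactly along η.

It remains that (At + Bt³)² increases strictly in |t| while κt² ≤ 1 (`sq_cubic_lt`), for which A > 0
and Aκ + 3B ≥ 0 suffice. By `cubic_coefficients_nonneg` the latter follows from s₂² ≤ 2b²s₁s₃, which
holds since s₂² ≤ s₁s₃ and 2b² = 4/π ≥ 1. The moment condition of part 2 is never needed. -/

theorem isProbabilityMeasure_uniform01 : IsProbabilityMeasure uniform01 :=
  ⟨by simp [uniform01]⟩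

/-! ### Moments of the mixing variable and the moment condition -/

theorem integrable_and_integral_slash_pow {q : ℝ} (hq : 0 < q) {m : ℕ} (hm : (m : ℝ) < q) :
    Integrable (fun u : ℝ => (u ^ (-1 / q)) ^ m) uniform01 ∧
      ∫ u, (u ^ (-1 / q)) ^ m ∂uniform01 = q / (q - m) := by
  have hr : -1 < -((m : ℝ) / q) := by
    rw [neg_lt_neg_iff, div_lt_one hq]; exact hm
  have heq : Set.EqOn (fun u : ℝ => u ^ (-((m : ℝ) / q))) (fun u : ℝ => (u ^ (-1 / q)) ^ m)
      (Set.Ioo 0 1) := by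
    intro u hu
    simp only
    rw [← Real.rpow_natCast, ← Real.rpow_mul hu.1.le]
    congr 1; ring
  have hint := intervalIntegral.intervalIntegrable_rpow' (a := 0) (b := 1) hr
  rw [intervalIntegrable_iff_integrableOn_Ioo_of_le zero_le_one] at hint
  refine ⟨hint.congr_fun heq measurableSet_Ioo, ?_⟩
  unfold uniform01
  rw [← setIntegral_congr_fun measurableSet_Ioo heq, ← integral_Ioc_eq_integral_Ioo,
    ← intervalIntegral.integral_of_le zero_le_one, integral_rpow (Or.inl hr)]
  have h1 : -((m : ℝ) / q) + 1 ≠ 0 := by linarith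
  rw [Real.zero_rpow h1, Real.one_rpow, show -((m : ℝ) / q) + 1 = (q - m) / q by field_simp; ring]
  simp

theorem slash_ratio {q : ℝ} (hq : 3 < q) :
    (q / (q - 2)) / (q / (q - 1)) ^ 2 = (q - 1) ^ 2 / (q * (q - 2)) := by
  have h1 : q - 2 ≠ 0 := by linarith
  have h2 : q - 1 ≠ 0 := by linarith
  field_simp

/-- Since q(q-2) = (q-1)² - 1, clearing denominators leaves 4 ≤ (4-π)(q-1)², and square roots may be
taken because q > 1. -/
theorem slash_ratio_le_iff {q : ℝ} (hq : 3 < q) :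
    (q - 1) ^ 2 / (q * (q - 2)) ≤ 4 / Real.pi ↔ 1 + 2 / √(4 - Real.pi) ≤ q := by
  have hpi := Real.pi_pos
  have hpi4 : 0 < 4 - Real.pi := by linarith [Real.pi_lt_four]
  have hs := Real.sqrt_pos.2 hpi4
  have hsq := Real.sq_sqrt hpi4.le
  have hqq : 0 < q * (q - 2) := mul_pos (by linarith) (by linarith)
  rw [div_le_div_iff₀ hqq hpi, ← le_sub_iff_add_le', div_le_iff₀ hs,
    ← abs_of_pos (show (0 : ℝ) < 2 by norm_num),
    ← abs_of_pos (mul_pos (show 0 < q - 1 by linarith) hs), ← sq_le_sq, mul_pow, hsq]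
  simp only [abs_of_pos (show (0 : ℝ) < 2 by norm_num)]
  constructor <;> intro h <;> nlinarith

theorem slash_moment_condition {q : ℝ} (hq : 4 ≤ q) :
    q / (q - 2) ≤ 4 / Real.pi * (q / (q - 1)) ^ 2 := by
  have hpi := Real.pi_pos
  have hpi' := Real.pi_lt_d2
  have h1 : 0 < q - 1 := by linarith
  have h2 : 0 < q - 2 := by linarith
  have hq0 : 0 < q := by linarith
  rw [div_pow, div_mul_div_comm, div_le_div_iff₀ h2 (by positivity)]
  have : Real.pi * (q - 1) ^ 2 ≤ 4 * (q * (q - 2)) := by nlinarith [sq_nonneg (q - 4)]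
  nlinarith [mul_le_mul_of_nonneg_left this hq0.le]

/-! ### The standard normal density and distribution function -/

theorem hasDerivAt_cdf_gaussianReal (x : ℝ) :
    HasDerivAt (cdf (gaussianReal 0 1)) (gaussianPDFReal 0 1 x) x := by
  have hcont : Continuous (gaussianPDFReal 0 1) := by
    unfold gaussianPDFReal; fun_prop
  have heq : ∀ y, cdf (gaussianReal 0 1) y =
      (∫ t in Set.Iic 0, gaussianPDFReal 0 1 t) + ∫ t in (0 : ℝ)..y, gaussianPDFReal 0 1 t := by
    intro y
    rw [cdf_eq_real, Measure.real, gaussianReal_apply_eq_integral 0 one_ne_zero,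
      ENNReal.toReal_ofReal (integral_nonneg fun t => gaussianPDFReal_nonneg 0 1 t),
      ← intervalIntegral.integral_Iic_sub_Iic (integrable_gaussianPDFReal 0 1).integrableOn
        (integrable_gaussianPDFReal 0 1).integrableOn]
    ring
  rw [funext heq]
  exact (intervalIntegral.integral_hasDerivAt_right (hcont.intervalIntegrable _ _)
    (hcont.stronglyMeasurableAtFilter _ _) hcont.continuousAt).const_add _

theorem continuous_cdf_gaussianReal : Continuous (cdf (gaussianReal 0 1)) :=
  continuous_iff_continuousAt.2 fun x => (hasDerivAt_cdf_gaussianReal x).continuousAt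

theorem cdf_gaussianReal_add_neg (x : ℝ) :
    cdf (gaussianReal 0 1) x + cdf (gaussianReal 0 1) (-x) = 1 := by
  have hmap : (gaussianReal 0 1).map (fun y : ℝ => -y) = gaussianReal 0 1 := by
    simpa using gaussianReal_map_neg (μ := 0) (v := 1)
  have h1 : cdf (gaussianReal 0 1) (-x) = (gaussianReal 0 1).real (Set.Ioi x) := by
    have := nullSingletonClass_gaussianReal (μ := 0) (one_ne_zero (α := NNReal))
    rw [cdf_eq_real, measureReal_congr (Ioi_ae_eq_Ici (a := x))]
    conv_lhs => rw [← hmap]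
    rw [map_measureReal_apply measurable_neg measurableSet_Iic]
    congr 1
    ext y; simp
  rw [h1, cdf_eq_real, ← Set.compl_Iic, probReal_compl_eq_one_sub measurableSet_Iic]
  ring

theorem hasDerivAt_gaussianPDFReal (x : ℝ) :
    HasDerivAt (gaussianPDFReal 0 1) (-(x * gaussianPDFReal 0 1 x)) x := by
  unfold gaussianPDFReal
  have h : HasDerivAt (fun y : ℝ => -(y - 0) ^ 2 / (2 * ((1 : NNReal) : ℝ))) (-x) x := by
    have := (((hasDerivAt_id' x).sub_const 0).pow 2).neg.div_const (2 * ((1 : NNReal) : ℝ))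
    refine this.congr_deriv ?_
    simp only [NNReal.coe_one]
    ring
  refine (h.exp.const_mul (√(2 * Real.pi * ((1 : NNReal) : ℝ)))⁻¹).congr_deriv ?_
  ring

theorem integrable_pow_of_memLp {T : Type*} [MeasurableSpace T] {μ : Measure T}
    [IsFiniteMeasure μ] {f : T → ℝ} {k : ℕ} (h : MemLp f k μ) :
    Integrable (fun x => f x ^ k) μ := by
  refine (integrable_norm_iff (h.1.pow k)).1 ?_
  simpa [norm_pow] using h.integrable_norm_pow'

theorem integrable_pow_gaussianReal (k : ℕ) :
    Integrable (fun x : ℝ => x ^ k) (gaussianReal 0 1) := by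
  have h : MemLp (fun x : ℝ => x) k (gaussianReal 0 1) := memLp_id_gaussianReal' k (by simp)
  exact integrable_pow_of_memLp h

theorem integrable_gaussianReal_iff (f : ℝ → ℝ) {v : NNReal} (hv : v ≠ 0) :
    Integrable f (gaussianReal 0 v) ↔ Integrable fun x => gaussianPDFReal 0 v x * f x := by
  rw [gaussianReal_of_var_ne_zero _ hv, integrable_withDensity_iff_integrable_smul'
    (measurable_gaussianPDF 0 v) (ae_of_all _ fun x => gaussianPDF_lt_top)]
  simp

theorem integral_gaussianReal (f : ℝ → ℝ) {v : NNReal} (hv : v ≠ 0) :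
    ∫ x, f x ∂(gaussianReal 0 v) = ∫ x, gaussianPDFReal 0 v x * f x :=
  integral_gaussianReal_eq_integral_smul hv

theorem integrable_mul_cdf {T : Type*} [MeasurableSpace T] {μ : Measure T} {f g : T → ℝ}
    (hf : Integrable f μ) (hg : AEMeasurable g μ) :
    Integrable (fun x => f x * cdf (gaussianReal 0 1) (g x)) μ := by
  refine hf.mul_bdd (c := 1)
    (continuous_cdf_gaussianReal.measurable.comp_aemeasurable hg).aestronglyMeasurable
    (ae_of_all _ fun x => ?_)
  rw [Real.norm_of_nonneg (cdf_nonneg _ _)]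
  exact cdf_le_one _ _

/-! ### One-dimensional moments weighted by Φ(cx) -/

/-- The constant `c / √(2π(1 + c²))`. -/
noncomputable def cdfMoment (c : ℝ) : ℝ := c / √(2 * Real.pi * (1 + c ^ 2))

/-- Precisions add: the exponents sum to -(1+c²)x²/2, a centred Gaussian of variance 1/(1+c²) up to
a constant. -/
theorem gaussianPDFReal_mul_gaussianPDFReal (c x : ℝ) :
    gaussianPDFReal 0 1 x * (c * gaussianPDFReal 0 1 (c * x)) =
      cdfMoment c * gaussianPDFReal 0 (Real.toNNReal (1 / (1 + c ^ 2))) x := by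
  have hc : 0 < 1 + c ^ 2 := by positivity
  have hpi := Real.pi_pos
  unfold gaussianPDFReal cdfMoment
  rw [Real.coe_toNNReal _ (by positivity)]
  have e1 : Real.exp (-(x - 0) ^ 2 / (2 * (1 / (1 + c ^ 2)))) =
      Real.exp (-(x - 0) ^ 2 / (2 * ((1 : NNReal) : ℝ))) *
        Real.exp (-(c * x - 0) ^ 2 / (2 * ((1 : NNReal) : ℝ))) := by
    rw [← Real.exp_add]
    congr 1
    simp only [NNReal.coe_one]
    field_simp
    ring
  have e2 : √(2 * Real.pi * (1 / (1 + c ^ 2))) = √(2 * Real.pi) / √(1 + c ^ 2) := by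
    rw [mul_one_div, Real.sqrt_div (by positivity)]
  have e3 : √(2 * Real.pi * (1 + c ^ 2)) = √(2 * Real.pi) * √(1 + c ^ 2) := by
    rw [Real.sqrt_mul (by positivity)]
  rw [e1, e2, e3]
  have h1 : 0 < √(2 * Real.pi) := by positivity
  have h2 : 0 < √(1 + c ^ 2) := by positivity
  simp only [NNReal.coe_one, mul_one]
  field_simp

theorem integral_pow_mul_deriv_cdf (c : ℝ) (f : ℝ → ℝ) :
    ∫ x, f x * (c * gaussianPDFReal 0 1 (c * x)) ∂(gaussianReal 0 1) =
      cdfMoment c * ∫ x, f x ∂(gaussianReal 0 (Real.toNNReal (1 / (1 + c ^ 2)))) := by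
  have hv : Real.toNNReal (1 / (1 + c ^ 2)) ≠ 0 := by
    rw [Ne, Real.toNNReal_eq_zero, not_le]; positivity
  rw [integral_gaussianReal f hv, integral_gaussianReal _ one_ne_zero, ← integral_const_mul]
  congr 1; ext x
  linear_combination f x * gaussianPDFReal_mul_gaussianPDFReal c x

theorem integrable_deriv_cdf (c : ℝ) {f : ℝ → ℝ} (hf : Integrable f (gaussianReal 0 1)) :
    Integrable (fun x => f x * (c * gaussianPDFReal 0 1 (c * x))) (gaussianReal 0 1) := by
  refine hf.mul_bdd (c := |c| * (√(2 * Real.pi))⁻¹)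
    (((measurable_gaussianPDFReal 0 1).comp (measurable_const_mul c)).const_mul
      c).aestronglyMeasurable (ae_of_all _ fun x => ?_)
  rw [Real.norm_eq_abs, abs_mul]
  gcongr
  rw [abs_of_nonneg (gaussianPDFReal_nonneg _ _ _)]
  unfold gaussianPDFReal
  simp only [NNReal.coe_one, mul_one]
  refine mul_le_of_le_one_right (by positivity) (Real.exp_le_one_iff.2 ?_)
  nlinarith [sq_nonneg (c * x - 0)]

/-- Gaussian integration by parts against the normal distribution function: if
`(g φ)' = -f φ`, then `E[f(N) Φ(cN)] = E[g(N) c φ(cN)]`. -/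
theorem integral_mul_cdf_eq (c : ℝ) {f g : ℝ → ℝ}
    (hd : ∀ x, HasDerivAt (fun y => g y * gaussianPDFReal 0 1 y)
      (-(f x * gaussianPDFReal 0 1 x)) x)
    (hf : Integrable f (gaussianReal 0 1)) (hg : Integrable g (gaussianReal 0 1)) :
    ∫ x, f x * cdf (gaussianReal 0 1) (c * x) ∂(gaussianReal 0 1) =
      ∫ x, g x * (c * gaussianPDFReal 0 1 (c * x)) ∂(gaussianReal 0 1) := by
  have hu : ∀ x, HasDerivAt (fun y => cdf (gaussianReal 0 1) (c * y))
      (c * gaussianPDFReal 0 1 (c * x)) x := by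
    intro x
    have := (hasDerivAt_cdf_gaussianReal (c * x)).comp x ((hasDerivAt_id x).const_mul c)
    simpa [Function.comp_def, mul_comm] using this
  have hm : AEMeasurable (fun x : ℝ => c * x) (gaussianReal 0 1) := by fun_prop
  have h1 := (integrable_gaussianReal_iff _ one_ne_zero).1 (integrable_mul_cdf hf hm)
  have h2 := (integrable_gaussianReal_iff _ one_ne_zero).1 (integrable_mul_cdf hg hm)
  have h3 := (integrable_gaussianReal_iff _ one_ne_zero).1 (integrable_deriv_cdf c hg)
  have key := integral_mul_deriv_eq_deriv_mul_of_integrable (fun x _ => hu x) (fun x _ => hd x)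
    (h1.neg.congr (ae_of_all _ fun x => by simp only [Pi.neg_apply, Pi.mul_apply]; ring))
    (h3.congr (ae_of_all _ fun x => by simp only [Pi.mul_apply]; ring))
    (h2.congr (ae_of_all _ fun x => by simp only [Pi.mul_apply]; ring))
  rw [integral_gaussianReal _ one_ne_zero, integral_gaussianReal _ one_ne_zero, ← neg_inj,
    ← integral_neg]
  calc _ = _ := integral_congr_ae (ae_of_all _ fun x => by ring)
    _ = _ := key
    _ = _ := congrArg Neg.neg (integral_congr_ae (ae_of_all _ fun x => by ring))

theorem integral_id_mul_cdf (c : ℝ) :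
    ∫ x, x * cdf (gaussianReal 0 1) (c * x) ∂(gaussianReal 0 1) = cdfMoment c := by
  rw [integral_mul_cdf_eq c (f := fun x => x) (g := fun _ => 1)
    (fun x => by simpa using hasDerivAt_gaussianPDFReal x)
    (by simpa using integrable_pow_gaussianReal 1) (integrable_const _),
    integral_pow_mul_deriv_cdf c (fun _ => 1)]
  simp

theorem integral_sq_gaussianReal (v : NNReal) : ∫ x, x ^ 2 ∂(gaussianReal 0 v) = v := by
  have h := variance_fun_id_gaussianReal (μ := 0) (v := v)
  rw [variance_of_integral_eq_zero (by fun_prop) (by simp)] at h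
  exact h

theorem integral_pow_three_mul_cdf (c : ℝ) :
    ∫ x, x ^ 3 * cdf (gaussianReal 0 1) (c * x) ∂(gaussianReal 0 1) =
      cdfMoment c * (2 + 1 / (1 + c ^ 2)) := by
  have h2 := integrable_pow_gaussianReal 2
  -- As φ' = -xφ, ((x²+2)φ)' = (2x - x³ - 2x)φ = -x³φ.
  rw [integral_mul_cdf_eq c (f := fun x => x ^ 3) (g := fun x => x ^ 2 + 2)
    (fun x => ?_) (integrable_pow_gaussianReal 3) (h2.add (integrable_const _)),
    integral_pow_mul_deriv_cdf c (fun x => x ^ 2 + 2), integral_add _ (integrable_const _),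
    integral_sq_gaussianReal, Real.coe_toNNReal _ (by positivity)]
  · simp [add_comm]
  · exact (memLp_id_gaussianReal' 2 (by simp)).integrable_sq
  · convert! (((hasDerivAt_id x).pow 2).add_const 2).mul (hasDerivAt_gaussianPDFReal x) using 1
    simp
    ring

/-! ### Linear forms of a standard normal vector -/

/-- The standard normal law on `Fin p → ℝ`. -/
noncomputable def stdNormal (p : ℕ) : Measure (Fin p → ℝ) :=
  Measure.pi fun _ => gaussianReal 0 1

instance (p : ℕ) : IsProbabilityMeasure (stdNormal p) := by
  unfold stdNormal; infer_instance

theorem hasGaussianLaw_stdNormal (p : ℕ) :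
    HasGaussianLaw (fun y : Fin p → ℝ => fun i => y i) (stdNormal p) := by
  refine iIndepFun.hasGaussianLaw (X := fun i (y : Fin p → ℝ) => y i) (fun i => ?_)
    (iIndepFun_pi (X := fun _ => id) fun i => aemeasurable_id)
  refine HasLaw.hasGaussianLaw (μ := gaussianReal 0 1) ?_
  exact (measurePreserving_eval (fun _ : Fin p => gaussianReal 0 1) i).hasLaw

/-- The linear form `y ↦ u ⬝ᵥ y`. -/
noncomputable def dotCLM {p : ℕ} (u : Fin p → ℝ) : (Fin p → ℝ) →L[ℝ] ℝ :=
  ∑ i, u i • ContinuousLinearMap.proj i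

theorem dotCLM_apply {p : ℕ} (u y : Fin p → ℝ) : dotCLM u y = u ⬝ᵥ y := by
  simp [dotCLM, dotProduct]

@[fun_prop]
theorem continuous_dotProduct_const_left {p : ℕ} (u : Fin p → ℝ) :
    Continuous fun y : Fin p → ℝ => u ⬝ᵥ y :=
  (dotCLM u).continuous.congr (dotCLM_apply u)

@[fun_prop]
theorem measurable_dotProduct_const_left {p : ℕ} (u : Fin p → ℝ) :
    Measurable fun y : Fin p → ℝ => u ⬝ᵥ y := (continuous_dotProduct_const_left u).measurable

theorem hasGaussianLaw_dotProduct_pair {p : ℕ} (u w : Fin p → ℝ) :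
    HasGaussianLaw (fun y => (u ⬝ᵥ y, w ⬝ᵥ y)) (stdNormal p) := by
  have := (hasGaussianLaw_stdNormal p).map_fun ((dotCLM u).prod (dotCLM w))
  simpa [dotCLM_apply] using this

theorem hasGaussianLaw_dotProduct {p : ℕ} (u : Fin p → ℝ) :
    HasGaussianLaw (fun y => u ⬝ᵥ y) (stdNormal p) := (hasGaussianLaw_dotProduct_pair u u).fst

theorem integral_dotProduct_stdNormal {p : ℕ} (u : Fin p → ℝ) :
    ∫ y, u ⬝ᵥ y ∂(stdNormal p) = 0 := by
  have hi : ∀ i, MeasurePreserving (fun y : Fin p → ℝ => y i) (stdNormal p) (gaussianReal 0 1) :=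
    fun i => measurePreserving_eval (fun _ : Fin p => gaussianReal 0 1) i
  simp only [dotProduct]
  rw [integral_finsetSum]
  · refine Finset.sum_eq_zero fun i _ => ?_
    rw [integral_const_mul]
    have := (hi i).hasLaw.integral_eq
    simp [this]
  · intro i _
    have h : Integrable (fun x : ℝ => x) (gaussianReal 0 1) := by
      simpa using integrable_pow_gaussianReal 1
    exact ((hi i).integrable_comp_of_integrable h).const_mul _

theorem covariance_dotProduct_stdNormal {p : ℕ} (u w : Fin p → ℝ) :
    cov[fun y => u ⬝ᵥ y, fun y => w ⬝ᵥ y; stdNormal p] = u ⬝ᵥ w := by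
  have hi : ∀ i, MeasurePreserving (fun y : Fin p → ℝ => y i) (stdNormal p) (gaussianReal 0 1) :=
    fun i => measurePreserving_eval (fun _ : Fin p => gaussianReal 0 1) i
  have hL : ∀ i, MemLp (fun y : Fin p → ℝ => y i) 2 (stdNormal p) := fun i =>
    (memLp_id_gaussianReal' 2 (by simp)).comp_measurePreserving (hi i)
  have hc : ∀ i j, cov[fun y : Fin p → ℝ => y i, fun y => y j; stdNormal p] =
      if i = j then 1 else 0 := by
    intro i j
    split_ifs with h
    · subst h
      rw [covariance_self (hi i).aemeasurable]
      have := (hi i).hasLaw.variance_eq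
      rw [this, variance_id_gaussianReal]; rfl
    · have hind : iIndepFun (fun i (y : Fin p → ℝ) => y i) (stdNormal p) :=
        iIndepFun_pi (X := fun _ => id) fun i => aemeasurable_id
      exact (hind.indepFun h).covariance_eq_zero (hL i) (hL j)
  simp only [dotProduct]
  rw [covariance_fun_sum_fun_sum (fun i => (hL i).const_mul _) (fun i => (hL i).const_mul _)]
  simp [covariance_const_mul_left, covariance_const_mul_right, hc, mul_comm]

theorem hasLaw_dotProduct {p : ℕ} (u : Fin p → ℝ) :
    HasLaw (fun y => u ⬝ᵥ y) (gaussianReal 0 (u ⬝ᵥ u).toNNReal) (stdNormal p) := by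
  refine ⟨by fun_prop, ?_⟩
  rw [(hasGaussianLaw_dotProduct u).map_eq_gaussianReal, integral_dotProduct_stdNormal,
    ← covariance_self (by fun_prop), covariance_dotProduct_stdNormal]

/-- Orthogonal forms are uncorrelated and jointly Gaussian, hence independent. -/
theorem hasLaw_dotProduct_pair {p : ℕ} {h e : Fin p → ℝ} (hhe : h ⬝ᵥ e = 0) :
    HasLaw (fun y => (h ⬝ᵥ y, e ⬝ᵥ y))
      ((gaussianReal 0 (h ⬝ᵥ h).toNNReal).prod (gaussianReal 0 (e ⬝ᵥ e).toNNReal))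
      (stdNormal p) := by
  have hind := (hasGaussianLaw_dotProduct_pair h e).indepFun_of_covariance_eq_zero
    ((covariance_dotProduct_stdNormal h e).trans hhe)
  refine ⟨by fun_prop, ?_⟩
  rw [(indepFun_iff_map_prod_eq_prod_map_map (by fun_prop) (by fun_prop)).1 hind,
    (hasLaw_dotProduct h).map_eq, (hasLaw_dotProduct e).map_eq]

/-! ### Odd moments of linear forms under the skewing weight -/

theorem integral_comp_neg_gaussianReal {f : ℝ → ℝ} (hf : Measurable f) (v : NNReal) :
    ∫ x, f (-x) ∂(gaussianReal 0 v) = ∫ x, f x ∂(gaussianReal 0 v) := by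
  have hmap : (gaussianReal 0 v).map (fun y : ℝ => -y) = gaussianReal 0 v := by
    simpa using gaussianReal_map_neg (μ := 0) (v := v)
  have h := integral_map (μ := gaussianReal 0 v) measurable_neg.aemeasurable
    hf.aestronglyMeasurable
  rw [← h, hmap]

theorem integral_pow_three_gaussianReal (v : NNReal) : ∫ x, x ^ 3 ∂(gaussianReal 0 v) = 0 := by
  have h := integral_comp_neg_gaussianReal (f := fun x => x ^ 3) (by fun_prop) v
  have h2 : ∀ x : ℝ, (-x) ^ 3 = -x ^ 3 := fun x => by ring
  simp only [h2, integral_neg] at h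
  linarith

theorem integrable_pow_gaussianReal_of_var (v : NNReal) (k : ℕ) :
    Integrable (fun x : ℝ => x ^ k) (gaussianReal 0 v) :=
  integrable_pow_of_memLp (memLp_id_gaussianReal' k (by simp))

theorem integral_add_mul_cdf_prod (v : NNReal) (c ρ : ℝ) :
    ∫ z : ℝ × ℝ, (z.1 + ρ * z.2) * cdf (gaussianReal 0 1) (c * z.2)
      ∂((gaussianReal 0 v).prod (gaussianReal 0 1)) = ρ * cdfMoment c := by
  have hm : AEMeasurable (fun x : ℝ => c * x) (gaussianReal 0 1) := by fun_prop
  have hΦ (k : ℕ) := integrable_mul_cdf (integrable_pow_gaussianReal k) hm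
  have hx (k : ℕ) := integrable_pow_gaussianReal_of_var v k
  calc _ = ∫ z : ℝ × ℝ, (z.1 ^ 1 * (z.2 ^ 0 * cdf (gaussianReal 0 1) (c * z.2)) +
        ρ * (z.1 ^ 0 * (z.2 ^ 1 * cdf (gaussianReal 0 1) (c * z.2))))
        ∂((gaussianReal 0 v).prod (gaussianReal 0 1)) :=
      integral_congr_ae (ae_of_all _ fun z => by ring)
    _ = _ := by
      rw [integral_add ((hx 1).mul_prod (hΦ 0)) (((hx 0).mul_prod (hΦ 1)).const_mul _),
        integral_const_mul,
        integral_prod_mul (fun x : ℝ => x ^ 1) (fun y => y ^ 0 * cdf (gaussianReal 0 1) (c * y)),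
        integral_prod_mul (fun x : ℝ => x ^ 0) (fun y => y ^ 1 * cdf (gaussianReal 0 1) (c * y))]
      simp [integral_id_mul_cdf]

/-- The weight involves only the second coordinate, so odd powers of the first integrate to zero;
the terms in `z.1 ^ 2 * z.2` and `z.2 ^ 3` remain. -/
theorem integral_add_pow_three_mul_cdf_prod (v : NNReal) (c ρ : ℝ) :
    ∫ z : ℝ × ℝ, (z.1 + ρ * z.2) ^ 3 * cdf (gaussianReal 0 1) (c * z.2)
      ∂((gaussianReal 0 v).prod (gaussianReal 0 1)) =
      cdfMoment c * (3 * ρ * v + ρ ^ 3 * (2 + 1 / (1 + c ^ 2))) := by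
  have hm : AEMeasurable (fun x : ℝ => c * x) (gaussianReal 0 1) := by fun_prop
  have hΦ (k : ℕ) := integrable_mul_cdf (integrable_pow_gaussianReal k) hm
  have hx (k : ℕ) := integrable_pow_gaussianReal_of_var v k
  have hI (i j : ℕ) := (hx i).mul_prod (hΦ j)
  have hE (i j : ℕ) : ∫ z : ℝ × ℝ, z.1 ^ i * (z.2 ^ j * cdf (gaussianReal 0 1) (c * z.2))
      ∂((gaussianReal 0 v).prod (gaussianReal 0 1)) = _ :=
    integral_prod_mul (fun x : ℝ => x ^ i) (fun y => y ^ j * cdf (gaussianReal 0 1) (c * y))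
  calc _ = ∫ z : ℝ × ℝ, ((z.1 ^ 3 * (z.2 ^ 0 * cdf (gaussianReal 0 1) (c * z.2)) +
        3 * ρ * (z.1 ^ 2 * (z.2 ^ 1 * cdf (gaussianReal 0 1) (c * z.2)))) +
        (3 * ρ ^ 2 * (z.1 ^ 1 * (z.2 ^ 2 * cdf (gaussianReal 0 1) (c * z.2))) +
        ρ ^ 3 * (z.1 ^ 0 * (z.2 ^ 3 * cdf (gaussianReal 0 1) (c * z.2)))))
        ∂((gaussianReal 0 v).prod (gaussianReal 0 1)) :=
      integral_congr_ae (ae_of_all _ fun z => by ring)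
    _ = _ := by
      rw [integral_add (by exact (hI 3 0).add ((hI 2 1).const_mul _))
        (by exact ((hI 1 2).const_mul _).add ((hI 0 3).const_mul _)),
        integral_add (hI 3 0) ((hI 2 1).const_mul _),
        integral_add ((hI 1 2).const_mul _) ((hI 0 3).const_mul _), integral_const_mul,
        integral_const_mul, integral_const_mul, hE 3 0, hE 2 1, hE 1 2, hE 0 3]
      simp only [integral_pow_three_mul_cdf, integral_pow_three_gaussianReal,
        integral_sq_gaussianReal, pow_one, integral_id_mul_cdf, integral_id_gaussianReal]
      simp
      ring

/-- First and third moments of a linear form of a standard normal vector, weighted by the skewing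
factor `2 Φ(w'y)`. -/
theorem integral_skew_moments {p : ℕ} (u w : Fin p → ℝ) (hw : w ≠ 0) :
    2 * ∫ y, (u ⬝ᵥ y) * cdf (gaussianReal 0 1) (w ⬝ᵥ y) ∂(stdNormal p) =
      √(2 / Real.pi) * (u ⬝ᵥ w / √(1 + w ⬝ᵥ w)) ∧
    2 * ∫ y, (u ⬝ᵥ y) ^ 3 * cdf (gaussianReal 0 1) (w ⬝ᵥ y) ∂(stdNormal p) =
      √(2 / Real.pi) * (3 * (u ⬝ᵥ u) * (u ⬝ᵥ w / √(1 + w ⬝ᵥ w)) -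
        (u ⬝ᵥ w / √(1 + w ⬝ᵥ w)) ^ 3) := by
  have hww : 0 < w ⬝ᵥ w := by
    simpa using (Matrix.dotProduct_star_self_pos_iff (v := w)).2 hw
  obtain ⟨c, hc, hcsq⟩ : ∃ c : ℝ, 0 < c ∧ c ^ 2 = w ⬝ᵥ w :=
    ⟨√(w ⬝ᵥ w), Real.sqrt_pos.2 hww, Real.sq_sqrt hww.le⟩
  obtain ⟨e, hwe, hee⟩ : ∃ e : Fin p → ℝ, w = c • e ∧ e ⬝ᵥ e = 1 := by
    refine ⟨c⁻¹ • w, by rw [smul_smul, mul_inv_cancel₀ hc.ne', one_smul], ?_⟩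
    rw [smul_dotProduct, dotProduct_smul, ← hcsq]
    simp only [smul_eq_mul]; field_simp
  -- Split `u` along the unit vector `e` of `w` and orthogonally to it: the weight sees only `e ⬝ᵥ
  -- y`, which is independent of `h ⬝ᵥ y`.
  set ρ := u ⬝ᵥ e with hρ
  set h : Fin p → ℝ := u - ρ • e with hh
  have hhe : h ⬝ᵥ e = 0 := by
    rw [hh, sub_dotProduct, smul_dotProduct, hee, ← hρ]; simp
  have hue : u = h + ρ • e := by rw [hh]; abel
  have huu : u ⬝ᵥ u = h ⬝ᵥ h + ρ ^ 2 := by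
    have h2 : e ⬝ᵥ h = 0 := by rw [dotProduct_comm, hhe]
    clear_value h ρ
    simp only [hue, add_dotProduct, dotProduct_add, dotProduct_smul, smul_dotProduct, hee, hhe, h2,
      smul_eq_mul]
    ring
  have hhh : 0 ≤ h ⬝ᵥ h := Finset.sum_nonneg fun i _ => mul_self_nonneg _
  have huw : u ⬝ᵥ w = ρ * c := by
    rw [hwe, dotProduct_smul, ← hρ, smul_eq_mul, mul_comm]
  have hlaw := hasLaw_dotProduct_pair hhe
  rw [hee, Real.toNNReal_one] at hlaw
  have hΦ : Measurable (cdf (gaussianReal 0 1)) := continuous_cdf_gaussianReal.measurable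
  have e1 := hlaw.integral_comp (f := fun z : ℝ × ℝ => (z.1 + ρ * z.2) *
    cdf (gaussianReal 0 1) (c * z.2)) (by fun_prop)
  have e3 := hlaw.integral_comp (f := fun z : ℝ × ℝ => (z.1 + ρ * z.2) ^ 3 *
    cdf (gaussianReal 0 1) (c * z.2)) (by fun_prop)
  rw [integral_add_mul_cdf_prod] at e1
  rw [integral_add_pow_three_mul_cdf_prod, Real.coe_toNNReal _ hhh] at e3
  have hy : ∀ y, u ⬝ᵥ y = h ⬝ᵥ y + ρ * (e ⬝ᵥ y) := by
    intro y
    conv_lhs => rw [hue, add_dotProduct, smul_dotProduct, smul_eq_mul]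
  have hy' : ∀ y, w ⬝ᵥ y = c * (e ⬝ᵥ y) := by
    intro y
    conv_lhs => rw [hwe, smul_dotProduct, smul_eq_mul]
  have hs : 2 * cdfMoment c = √(2 / Real.pi) * (c / √(1 + c ^ 2)) := by
    have hpi := Real.pi_pos
    rw [cdfMoment, Real.sqrt_mul (by positivity), Real.sqrt_mul (by positivity),
      Real.sqrt_div (by positivity)]
    have h2 : √(2 : ℝ) ^ 2 = 2 := Real.sq_sqrt (by norm_num)
    have : 0 < √(1 + c ^ 2) := by positivity
    field_simp
    linarith
  have hk : √(1 + c ^ 2) ^ 2 = 1 + c ^ 2 := Real.sq_sqrt (by positivity)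
  have hk0 : 0 < √(1 + c ^ 2) := by positivity
  simp only [Function.comp_def] at e1 e3
  constructor
  · rw [huw, ← hcsq]
    simp only [hy, hy']
    rw [e1]
    linear_combination ρ * hs
  · have e3' : 2 * ∫ y, (u ⬝ᵥ y) ^ 3 * cdf (gaussianReal 0 1) (w ⬝ᵥ y) ∂(stdNormal p) =
        2 * cdfMoment c * (3 * ρ * (h ⬝ᵥ h) + ρ ^ 3 * (2 + 1 / (1 + c ^ 2))) := by
      simp only [hy, hy']
      rw [e3]; ring
    rw [e3', hs, huw, ← hcsq, huu, div_pow]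
    have : c ^ 2 = √(1 + c ^ 2) ^ 2 - 1 := by linarith
    generalize √(1 + c ^ 2) = k at *
    rw [← hk]
    field_simp
    rw [this]
    ring

/-! ### Multivariate normal densities under linear maps -/

theorem prod_gaussianPDFReal {p : ℕ} (y : Fin p → ℝ) :
    ∏ i, gaussianPDFReal 0 1 (y i) =
      (√((2 * Real.pi) ^ p))⁻¹ * Real.exp (-(y ⬝ᵥ y) / 2) := by
  have hpi := Real.pi_pos
  simp only [gaussianPDFReal, Finset.prod_mul_distrib, Finset.prod_const, Finset.card_univ,
    Fintype.card_fin, ← Real.exp_sum, NNReal.coe_one, mul_one, sub_zero]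
  congr 1
  · rw [inv_pow]
    congr 1
    rw [← Real.sqrt_sq (show 0 ≤ √(2 * Real.pi) ^ p by positivity), ← pow_mul, mul_comm p 2,
      pow_mul, Real.sq_sqrt (by positivity)]
  · rw [← Finset.sum_div, Finset.sum_neg_distrib]
    simp only [dotProduct, sq]

/-- A product measure is determined by its values on boxes, where the integral of the product
density factorizes. -/
theorem stdNormal_eq_withDensity (p : ℕ) :
    stdNormal p = volume.withDensity fun y =>
      ENNReal.ofReal (∏ i, gaussianPDFReal 0 1 (y i)) := by
  unfold stdNormal
  refine Measure.pi_eq fun s hs => ?_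
  rw [withDensity_apply _ (MeasurableSet.univ_pi hs)]
  have hI (i : Fin p) : Integrable ((s i).indicator (gaussianPDFReal 0 1)) :=
    (integrable_gaussianPDFReal 0 1).indicator (hs i)
  have h0 (i : Fin p) (x : ℝ) : 0 ≤ (s i).indicator (gaussianPDFReal 0 1) x :=
    Set.indicator_nonneg (fun _ _ => gaussianPDFReal_nonneg _ _ _) _
  have h1 (y : Fin p → ℝ) : (Set.univ.pi s).indicator
      (fun y => ENNReal.ofReal (∏ i, gaussianPDFReal 0 1 (y i))) y =
      ENNReal.ofReal (∏ i, (s i).indicator (gaussianPDFReal 0 1) (y i)) := by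
    by_cases hy : y ∈ Set.univ.pi s
    · rw [Set.indicator_of_mem hy]
      congr 1
      exact Finset.prod_congr rfl fun i _ => (Set.indicator_of_mem (hy i trivial) _).symm
    · rw [Set.indicator_of_notMem hy]
      simp only [Set.mem_pi, Set.mem_univ, forall_const, not_forall] at hy
      obtain ⟨i, hi⟩ := hy
      rw [Finset.prod_eq_zero (Finset.mem_univ i) (Set.indicator_of_notMem hi _),
        ENNReal.ofReal_zero]
  have hprod : Integrable (fun y : Fin p → ℝ => ∏ i, (s i).indicator (gaussianPDFReal 0 1) (y i)) :=
    Integrable.fintype_prod hI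
  rw [← lintegral_indicator (MeasurableSet.univ_pi hs), lintegral_congr h1,
    ← ofReal_integral_eq_lintegral_ofReal
      hprod
      (ae_of_all _ fun y => Finset.prod_nonneg fun i _ => h0 i _),
    integral_fintype_prod_volume_eq_prod (fun i => (s i).indicator (gaussianPDFReal 0 1)),
    ENNReal.ofReal_prod_of_nonneg fun i _ => integral_nonneg (h0 i)]
  refine Finset.prod_congr rfl fun i _ => ?_
  rw [integral_indicator (hs i), gaussianReal_apply_eq_integral 0 one_ne_zero]

theorem map_withDensity_comp {S T : Type*} [MeasurableSpace S] [MeasurableSpace T]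
    {μ : Measure S} {L : S → T} (hL : Measurable L) {g : T → ENNReal} (hg : Measurable g) :
    (μ.withDensity fun y => g (L y)).map L = (μ.map L).withDensity g := by
  ext s hs
  rw [Measure.map_apply hL hs, withDensity_apply _ (hL hs), withDensity_apply _ hs,
    setLIntegral_map hs hg hL]

open scoped MatrixOrder Matrix.Norms.L2Operator in
theorem exists_transpose_mul_self {p : ℕ} {C : Matrix (Fin p) (Fin p) ℝ} (hC : C.PosDef) :
    ∃ B : Matrix (Fin p) (Fin p) ℝ, B.det ≠ 0 ∧ C = Bᵀ * B := by
  obtain ⟨B, hB, h⟩ :=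
    CStarAlgebra.isStrictlyPositive_iff_eq_star_mul_self.mp hC.isStrictlyPositive
  refine ⟨B, ((Matrix.isUnit_iff_isUnit_det B).1 hB).ne_zero, ?_⟩
  rw [h, Matrix.star_eq_conjTranspose, Matrix.conjTranspose_eq_transpose_of_trivial]

theorem dotProduct_transpose_mulVec {p : ℕ} (B : Matrix (Fin p) (Fin p) ℝ) (a y : Fin p → ℝ) :
    a ⬝ᵥ Bᵀ *ᵥ y = B *ᵥ a ⬝ᵥ y := by
  rw [Matrix.dotProduct_mulVec, Matrix.vecMul_transpose]

theorem mulVec_dotProduct_mulVec {p : ℕ} (B : Matrix (Fin p) (Fin p) ℝ) (a b : Fin p → ℝ) :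
    B *ᵥ a ⬝ᵥ B *ᵥ b = a ⬝ᵥ (Bᵀ * B) *ᵥ b := by
  rw [← dotProduct_transpose_mulVec, Matrix.mulVec_mulVec]

theorem measurable_normalDensity {p : ℕ} (C : Matrix (Fin p) (Fin p) ℝ) :
    Measurable (normalDensity C) := by
  unfold normalDensity Matrix.mulVec dotProduct
  fun_prop

/-- The factor |det B| separating the two densities cancels the Jacobian of Bᵀ acting on Lebesgue
measure. -/
theorem map_stdNormal {p : ℕ} {B : Matrix (Fin p) (Fin p) ℝ} (hB : B.det ≠ 0) :
    (stdNormal p).map (fun y => Bᵀ *ᵥ y) =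
      volume.withDensity fun z => ENNReal.ofReal (normalDensity (Bᵀ * B) z) := by
  have hpi := Real.pi_pos
  have hBu : IsUnit B.det := isUnit_iff_ne_zero.2 hB
  have hBt : Bᵀ.det ≠ 0 := by rwa [Matrix.det_transpose]
  have hL : Measurable fun y : Fin p → ℝ => Bᵀ *ᵥ y := by
    unfold Matrix.mulVec dotProduct; fun_prop
  have hdens (y : Fin p → ℝ) : ENNReal.ofReal (∏ i, gaussianPDFReal 0 1 (y i)) =
      ENNReal.ofReal |B.det| * ENNReal.ofReal (normalDensity (Bᵀ * B) (Bᵀ *ᵥ y)) := by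
    rw [← ENNReal.ofReal_mul (abs_nonneg _), prod_gaussianPDFReal, normalDensity]
    have e1 : Bᵀ *ᵥ y ⬝ᵥ (Bᵀ * B)⁻¹ *ᵥ Bᵀ *ᵥ y = y ⬝ᵥ y := by
      rw [← dotProduct_transpose_mulVec, Matrix.transpose_transpose, Matrix.mulVec_mulVec,
        Matrix.mulVec_mulVec, Matrix.mul_inv_rev, Matrix.mul_assoc, Matrix.mul_assoc,
        Matrix.nonsing_inv_mul _ (isUnit_iff_ne_zero.2 hBt), Matrix.mul_one,
        Matrix.mul_nonsing_inv _ hBu, Matrix.one_mulVec]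
    have e2 : √((2 * Real.pi) ^ p * (Bᵀ * B).det) = √((2 * Real.pi) ^ p) * |B.det| := by
      rw [Matrix.det_mul, Matrix.det_transpose, Real.sqrt_mul (by positivity),
        Real.sqrt_mul_self_eq_abs]
    have h3 : 0 < |B.det| := abs_pos.2 hB
    rw [e1, e2]
    congr 1
    field_simp
  have hg : Measurable fun z => ENNReal.ofReal (normalDensity (Bᵀ * B) z) :=
    (measurable_normalDensity _).ennreal_ofReal
  rw [stdNormal_eq_withDensity, funext hdens,
    map_withDensity_comp hL (g := fun z => ENNReal.ofReal |B.det| *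
      ENNReal.ofReal (normalDensity (Bᵀ * B) z)) (hg.const_mul _)]
  have hm := Real.map_matrix_volume_pi_eq_smul_volume_pi hBt
  rw [show (fun y : Fin p → ℝ => Bᵀ *ᵥ y) = Matrix.toLin' Bᵀ by
    ext y; rw [Matrix.toLin'_apply], hm, withDensity_smul_measure, ← withDensity_smul _
      (hg.const_mul _)]
  congr 1
  ext z
  rw [Pi.smul_apply, smul_eq_mul, ← mul_assoc, ← ENNReal.ofReal_mul (abs_nonneg _), ← abs_mul,
    Matrix.det_transpose, inv_mul_cancel₀ hB, abs_one, ENNReal.ofReal_one, one_mul]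

/-! ### The skew-normal law and its moments -/

theorem normalDensity_nonneg {p : ℕ} (C : Matrix (Fin p) (Fin p) ℝ) (z : Fin p → ℝ) :
    0 ≤ normalDensity C z := by unfold normalDensity; positivity

theorem measurable_skew_weight {p : ℕ} (α : Fin p → ℝ) :
    Measurable fun z : Fin p → ℝ => ENNReal.ofReal (2 * cdf (gaussianReal 0 1) (α ⬝ᵥ z)) :=
  ((continuous_cdf_gaussianReal.measurable.comp
    (measurable_dotProduct_const_left α)).const_mul 2).ennreal_ofReal

theorem skewNormal_eq {p : ℕ} {B : Matrix (Fin p) (Fin p) ℝ} (hB : B.det ≠ 0) (α : Fin p → ℝ) :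
    skewNormal (Bᵀ * B) α = ((stdNormal p).map fun y => Bᵀ *ᵥ y).withDensity fun z =>
      ENNReal.ofReal (2 * cdf (gaussianReal 0 1) (α ⬝ᵥ z)) := by
  rw [map_stdNormal hB, ← withDensity_mul _ (measurable_normalDensity _).ennreal_ofReal
    (measurable_skew_weight α), skewNormal]
  congr 1
  ext z
  rw [Pi.mul_apply, ← ENNReal.ofReal_mul (normalDensity_nonneg _ _)]
  congr 1
  ring

theorem integral_skewNormal {p : ℕ} {B : Matrix (Fin p) (Fin p) ℝ} (hB : B.det ≠ 0)
    (α : Fin p → ℝ) {f : (Fin p → ℝ) → ℝ} (hf : Measurable f) :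
    ∫ z, f z ∂(skewNormal (Bᵀ * B) α) =
      2 * ∫ y, f (Bᵀ *ᵥ y) * cdf (gaussianReal 0 1) (B *ᵥ α ⬝ᵥ y) ∂(stdNormal p) := by
  have hL : Measurable fun y : Fin p → ℝ => Bᵀ *ᵥ y := by
    unfold Matrix.mulVec dotProduct; fun_prop
  have hΦ : Measurable fun z : Fin p → ℝ => cdf (gaussianReal 0 1) (α ⬝ᵥ z) :=
    continuous_cdf_gaussianReal.measurable.comp (measurable_dotProduct_const_left α)
  have h2 (x : ℝ) : 0 ≤ 2 * cdf (gaussianReal 0 1) x := mul_nonneg zero_le_two (cdf_nonneg _ _)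
  rw [skewNormal_eq hB, integral_withDensity_eq_integral_toReal_smul (measurable_skew_weight α)
    (ae_of_all _ fun z => ENNReal.ofReal_lt_top), ← integral_const_mul]
  simp only [ENNReal.toReal_ofReal (h2 _), smul_eq_mul]
  rw [integral_map hL.aemeasurable (by exact ((hΦ.const_mul 2).mul hf).aestronglyMeasurable)]
  refine integral_congr_ae (ae_of_all _ fun y => ?_)
  simp only [dotProduct_transpose_mulVec]
  ring

/-- Averaging over y and -y replaces the weight 2Φ by 1, because Φ(x) + Φ(-x) = 1. This yields the
total mass and the second moments of the skew-normal law. -/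
theorem integral_even_mul_cdf {p : ℕ} (w : Fin p → ℝ) {f : (Fin p → ℝ) → ℝ}
    (hf : Integrable f (stdNormal p)) (heven : ∀ y, f (-y) = f y) :
    2 * ∫ y, f y * cdf (gaussianReal 0 1) (w ⬝ᵥ y) ∂(stdNormal p) = ∫ y, f y ∂(stdNormal p) := by
  have hneg : MeasurePreserving (fun x : ℝ => -x) (gaussianReal 0 1) (gaussianReal 0 1) :=
    ⟨measurable_neg, by simpa using gaussianReal_map_neg (μ := 0) (v := 1)⟩
  have hmp : MeasurePreserving (MeasurableEquiv.neg (Fin p → ℝ)) (stdNormal p) (stdNormal p) :=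
    measurePreserving_pi (fun _ => gaussianReal 0 1) (fun _ => gaussianReal 0 1) fun _ => hneg
  have hI := integrable_mul_cdf hf (measurable_dotProduct_const_left w).aemeasurable
  have h := hmp.integral_comp' fun y => f y * cdf (gaussianReal 0 1) (w ⬝ᵥ y)
  have h2 (y : Fin p → ℝ) : f (MeasurableEquiv.neg (Fin p → ℝ) y) *
      cdf (gaussianReal 0 1) (w ⬝ᵥ MeasurableEquiv.neg (Fin p → ℝ) y) =
      f y - f y * cdf (gaussianReal 0 1) (w ⬝ᵥ y) := by
    have : MeasurableEquiv.neg (Fin p → ℝ) y = -y := rfl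
    rw [this, heven, dotProduct_neg]
    linear_combination f y * cdf_gaussianReal_add_neg (w ⬝ᵥ y)
  simp only [h2] at h
  rw [integral_sub hf hI] at h
  linarith

theorem isProbabilityMeasure_skewNormal {p : ℕ} {C : Matrix (Fin p) (Fin p) ℝ} (hC : C.PosDef)
    (α : Fin p → ℝ) : IsProbabilityMeasure (skewNormal C α) := by
  obtain ⟨B, hB, rfl⟩ := exists_transpose_mul_self hC
  have h := integral_skewNormal hB α (f := fun _ => 1) measurable_const
  rw [integral_even_mul_cdf _ (integrable_const _) (fun _ => rfl)] at h
  simp only [integral_const, probReal_univ, smul_eq_mul, mul_one] at h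
  exact ⟨by rwa [Measure.real, ENNReal.toReal_eq_one_iff] at h⟩

/-- As Φ ≤ 1, the law is dominated by twice a Gaussian law. -/
theorem memLp_dotProduct_skewNormal {p : ℕ} {C : Matrix (Fin p) (Fin p) ℝ} (hC : C.PosDef)
    (α a : Fin p → ℝ) {k : ENNReal} (hk : k ≠ ⊤) :
    MemLp (fun z => a ⬝ᵥ z) k (skewNormal C α) := by
  obtain ⟨B, hB, rfl⟩ := exists_transpose_mul_self hC
  have hL : Measurable fun y : Fin p → ℝ => Bᵀ *ᵥ y := by
    unfold Matrix.mulVec dotProduct; fun_prop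
  rw [skewNormal_eq hB]
  have h1 : MemLp (fun z => a ⬝ᵥ z) k ((stdNormal p).map fun y => Bᵀ *ᵥ y) := by
    rw [memLp_map_measure_iff (measurable_dotProduct_const_left a).aestronglyMeasurable
      hL.aemeasurable]
    have := (hasGaussianLaw_dotProduct (B *ᵥ a)).memLp hk
    simpa only [Function.comp_def, dotProduct_transpose_mulVec] using this
  refine (h1.smul_measure (c := 2) (by simp)).mono_measure ?_
  rw [← withDensity_const]
  refine withDensity_mono (ae_of_all _ fun z => ?_)
  rw [ENNReal.ofReal_le_iff_le_toReal (by simp)]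
  simpa using cdf_le_one (gaussianReal 0 1) (α ⬝ᵥ z)

/-- The first three moments of the linear forms of a skew-normal vector. -/
theorem integral_dotProduct_skewNormal {p : ℕ} {C : Matrix (Fin p) (Fin p) ℝ} (hC : C.PosDef)
    {α : Fin p → ℝ} (hα : α ≠ 0) (a : Fin p → ℝ) :
    ∫ z, a ⬝ᵥ z ∂(skewNormal C α) =
      √(2 / Real.pi) * (a ⬝ᵥ C *ᵥ α / √(1 + α ⬝ᵥ C *ᵥ α)) ∧
    ∫ z, (a ⬝ᵥ z) ^ 2 ∂(skewNormal C α) = a ⬝ᵥ C *ᵥ a ∧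
    ∫ z, (a ⬝ᵥ z) ^ 3 ∂(skewNormal C α) =
      √(2 / Real.pi) * (3 * (a ⬝ᵥ C *ᵥ a) * (a ⬝ᵥ C *ᵥ α / √(1 + α ⬝ᵥ C *ᵥ α)) -
        (a ⬝ᵥ C *ᵥ α / √(1 + α ⬝ᵥ C *ᵥ α)) ^ 3) := by
  obtain ⟨B, hB, rfl⟩ := exists_transpose_mul_self hC
  have hw : B *ᵥ α ≠ 0 := fun h => hα (Matrix.eq_zero_of_mulVec_eq_zero hB h)
  have hm := measurable_dotProduct_const_left a
  obtain ⟨h1, h3⟩ := integral_skew_moments (B *ᵥ a) (B *ᵥ α) hw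
  rw [integral_skewNormal hB α hm, integral_skewNormal hB α (hm.pow_const 2),
    integral_skewNormal hB α (hm.pow_const 3)]
  simp only [mulVec_dotProduct_mulVec] at h1 h3
  simp only [dotProduct_transpose_mulVec]
  refine ⟨h1, ?_, h3⟩
  have hg := hasGaussianLaw_dotProduct (B *ᵥ a)
  rw [integral_even_mul_cdf _ hg.memLp_two.integrable_sq (fun y => by rw [dotProduct_neg, neg_sq]),
    ← mulVec_dotProduct_mulVec, ← covariance_dotProduct_stdNormal,
    covariance_self (by fun_prop), variance_of_integral_eq_zero (by fun_prop)
      (integral_dotProduct_stdNormal _)]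

/-! ### Moments of a shifted product of independent variables -/

section ScaleMixture

variable {S T : Type*} [MeasurableSpace S] [MeasurableSpace T] {μ : Measure S} {ν : Measure T}
  [IsProbabilityMeasure μ] [IsProbabilityMeasure ν] {f : S → ℝ} {g : T → ℝ}

theorem memLp_three_mul_prod (hf : MemLp f 3 μ) (hg : MemLp g 3 ν) (c : ℝ) :
    MemLp (fun z : S × T => c + f z.1 * g z.2) 3 (μ.prod ν) := by
  refine (memLp_const c).add ?_
  have hm : AEStronglyMeasurable (fun z : S × T => f z.1 * g z.2) (μ.prod ν) :=
    hf.1.comp_fst.mul hg.1.comp_snd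
  refine (integrable_norm_rpow_iff hm (by simp) (by simp)).1 ?_
  have h1 := hf.integrable_norm_rpow (by simp) (by simp)
  have h2 := hg.integrable_norm_rpow (by simp) (by simp)
  refine (h1.mul_prod h2).congr (ae_of_all _ fun z => ?_)
  simp only [norm_mul]
  rw [Real.mul_rpow (norm_nonneg _) (norm_nonneg _)]

theorem integral_pow_mul_prod (k : ℕ) :
    ∫ z : S × T, (f z.1 * g z.2) ^ k ∂(μ.prod ν) = (∫ x, f x ^ k ∂μ) * ∫ y, g y ^ k ∂ν := by
  simp only [mul_pow]
  exact integral_prod_mul (fun x => f x ^ k) fun y => g y ^ k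

theorem integrable_pow_mul_prod (hf : MemLp f 3 μ) (hg : MemLp g 3 ν) {k : ℕ} (hk : k ≤ 3) :
    Integrable (fun z : S × T => (f z.1 * g z.2) ^ k) (μ.prod ν) := by
  have h := memLp_three_mul_prod hf hg 0
  simp only [zero_add] at h
  exact integrable_pow_of_memLp (h.mono_exponent (by exact_mod_cast hk))

theorem integral_scale_mixture (hf : MemLp f 3 μ) (hg : MemLp g 3 ν) (c : ℝ) :
    ∫ z : S × T, (c + f z.1 * g z.2) ∂(μ.prod ν) = c + (∫ x, f x ∂μ) * ∫ y, g y ∂ν := by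
  have h1 := integrable_pow_mul_prod hf hg (k := 1) (by norm_num)
  simp only [pow_one] at h1
  rw [integral_add (integrable_const c) h1, integral_prod_mul]
  simp

theorem variance_scale_mixture (hf : MemLp f 3 μ) (hg : MemLp g 3 ν) (c : ℝ) :
    Var[fun z : S × T => c + f z.1 * g z.2; μ.prod ν] =
      (∫ x, f x ^ 2 ∂μ) * (∫ y, g y ^ 2 ∂ν) - ((∫ x, f x ∂μ) * ∫ y, g y ∂ν) ^ 2 := by
  have hm : AEStronglyMeasurable (fun z : S × T => f z.1 * g z.2) (μ.prod ν) :=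
    hf.1.comp_fst.mul hg.1.comp_snd
  have h := memLp_three_mul_prod hf hg 0
  simp only [zero_add] at h
  rw [variance_const_add hm, variance_eq_sub (h.mono_exponent (by norm_num)), integral_prod_mul]
  simp only [Pi.pow_apply, integral_pow_mul_prod]

theorem integral_central_three_scale_mixture (hf : MemLp f 3 μ) (hg : MemLp g 3 ν) (c : ℝ) :
    ∫ z : S × T, (c + f z.1 * g z.2 - (c + (∫ x, f x ∂μ) * ∫ y, g y ∂ν)) ^ 3 ∂(μ.prod ν) =
      (∫ x, f x ^ 3 ∂μ) * (∫ y, g y ^ 3 ∂ν) -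
        3 * ((∫ x, f x ^ 2 ∂μ) * ∫ y, g y ^ 2 ∂ν) * ((∫ x, f x ∂μ) * ∫ y, g y ∂ν) +
        2 * ((∫ x, f x ∂μ) * ∫ y, g y ∂ν) ^ 3 := by
  set m := (∫ x, f x ∂μ) * ∫ y, g y ∂ν with hm
  have h1 := integrable_pow_mul_prod hf hg (k := 1) (by norm_num)
  have h2 := integrable_pow_mul_prod hf hg (k := 2) (by norm_num)
  have h3 := integrable_pow_mul_prod hf hg (k := 3) le_rfl
  have e1 := integral_pow_mul_prod (μ := μ) (ν := ν) (f := f) (g := g) 1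
  simp only [pow_one] at e1
  calc _ = ∫ z : S × T, (((f z.1 * g z.2) ^ 3 - 3 * m * (f z.1 * g z.2) ^ 2) +
        (3 * m ^ 2 * (f z.1 * g z.2) ^ 1 - m ^ 3)) ∂(μ.prod ν) :=
        integral_congr_ae (ae_of_all _ fun z => by ring)
    _ = _ := by
      rw [integral_add (by exact h3.sub (h2.const_mul _))
        (by exact (h1.const_mul _).sub (integrable_const _)),
        integral_sub h3 (h2.const_mul _), integral_sub (h1.const_mul _) (integrable_const _),
        integral_const_mul, integral_const_mul, integral_pow_mul_prod, integral_pow_mul_prod]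
      simp only [pow_one, e1, ← hm, integral_const, probReal_univ, one_smul]
      ring

end ScaleMixture

/-! ### Covariance matrix and skewness of projections -/

theorem dotProduct_covMatrix_mulVec {S : Type*} [MeasurableSpace S] {P : Measure S}
    [IsProbabilityMeasure P] {p : ℕ} {X : S → Fin p → ℝ} (hX : ∀ i, MemLp (fun s => X s i) 2 P)
    (d : Fin p → ℝ) :
    d ⬝ᵥ covMatrix X P *ᵥ d = Var[fun s => d ⬝ᵥ X s; P] := by
  have hm : AEMeasurable (fun s => d ⬝ᵥ X s) P := by
    simp only [dotProduct]
    exact Finset.aemeasurable_fun_sum _ fun i _ => (hX i).1.aemeasurable.const_mul _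
  rw [← covariance_self hm]
  simp only [dotProduct]
  rw [covariance_fun_sum_fun_sum (fun i => (hX i).const_mul _) (fun i => (hX i).const_mul _)]
  simp only [covMatrix, Matrix.mulVec, dotProduct, Matrix.of_apply, Finset.mul_sum,
    covariance_const_mul_left, covariance_const_mul_right]
  exact Finset.sum_congr rfl fun i _ => Finset.sum_congr rfl fun j _ => by ring

theorem skewness_congr {S T : Type*} [MeasurableSpace S] [MeasurableSpace T] {P : Measure S}
    {Q : Measure T} {Y : S → ℝ} {Z : T → ℝ} (h : IdentDistrib Y Z P Q) :
    skewness Y P = skewness Z Q := by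
  unfold skewness
  rw [h.variance_eq, h.integral_eq]
  have := (h.comp (u := fun y => ((y - ∫ t, Z t ∂Q) / √(Var[Z; Q])) ^ 3)
    (by fun_prop)).integral_eq
  simp only [Function.comp_def] at this
  rw [this]

/-! ### The optimization problem -/

/-- For 0 ≤ t < u the cubic grows by (u-t)(A + B(t²+tu+u²)), and t²+tu+u² < 3u² ≤ 3/κ. The first
inequality being strict, the second factor is positive even if Aκ + 3B = 0. -/
theorem sq_cubic_lt {A B κ t u : ℝ} (hA : 0 < A) (hκ : 0 < κ) (hB : 0 ≤ A * κ + 3 * B)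
    (hu : u ^ 2 * κ ≤ 1) (htu : t ^ 2 < u ^ 2) :
    (A * t + B * t ^ 3) ^ 2 < (A * u + B * u ^ 3) ^ 2 := by
  -- The cubic is odd, so its square depends only on the absolute value.
  wlog h0 : 0 ≤ t ∧ 0 ≤ u generalizing t u
  · have := this (t := |t|) (u := |u|) (by rwa [sq_abs]) (by rwa [sq_abs, sq_abs])
      ⟨abs_nonneg _, abs_nonneg _⟩
    have hx : ∀ x : ℝ, (A * |x| + B * |x| ^ 3) ^ 2 = (A * x + B * x ^ 3) ^ 2 := fun x => by
      rcases abs_choice x with h | h <;> rw [h]; ring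
    rwa [hx, hx] at this
  obtain ⟨ht, hu0⟩ := h0
  have hlt : t < u := lt_of_pow_lt_pow_left₀ 2 hu0 htu
  have hsum : t ^ 2 + t * u + u ^ 2 < 3 * u ^ 2 := by nlinarith
  have hpos : ∀ y, 0 ≤ y → y < 3 * u ^ 2 → 0 < A + B * y := by
    intro y hy hyu
    rcases le_or_gt 0 B with hb | hb
    · positivity
    · have h1 : B * (y * κ) > B * 3 :=
        mul_lt_mul_of_neg_left (by nlinarith) hb
      have h2 : 0 < (A + B * y) * κ := by nlinarith
      exact pos_of_mul_pos_left h2 hκ.le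
  have hu2 : 0 < u := lt_of_le_of_lt ht hlt
  have h1 := hpos (t ^ 2 + t * u + u ^ 2) (by positivity) hsum
  have h2 := hpos (t ^ 2) (by positivity) (by nlinarith)
  refine pow_lt_pow_left₀ ?_ ?_ two_ne_zero
  · nlinarith [mul_pos (sub_pos.2 hlt) h1]
  · nlinarith [mul_nonneg ht h2.le]

theorem sq_cubic_le {A B κ t u : ℝ} (hA : 0 < A) (hκ : 0 < κ) (hB : 0 ≤ A * κ + 3 * B)
    (hu : u ^ 2 * κ ≤ 1) (htu : t ^ 2 ≤ u ^ 2) :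
    (A * t + B * t ^ 3) ^ 2 ≤ (A * u + B * u ^ 3) ^ 2 := by
  rcases htu.lt_or_eq with h | h
  · exact (sq_cubic_lt hA hκ hB hu h).le
  · have hx : ∀ x : ℝ, (A * x + B * x ^ 3) ^ 2 = x ^ 2 * (A + B * x ^ 2) ^ 2 := fun x => by ring
    rw [hx, hx, h]

/-- The defect in the Cauchy–Schwarz inequality for a positive definite form. -/
theorem exists_dotProduct_eq_add_defect {p : ℕ} {C : Matrix (Fin p) (Fin p) ℝ} (hC : C.PosDef)
    {α : Fin p → ℝ} (hα : α ≠ 0) (a : Fin p → ℝ) :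
    ∃ D : ℝ, 0 ≤ D ∧ (D = 0 ↔ ∃ r : ℝ, a = r • α) ∧
      a ⬝ᵥ C *ᵥ a = (a ⬝ᵥ C *ᵥ α) ^ 2 / (α ⬝ᵥ C *ᵥ α) + D := by
  have hv : 0 < α ⬝ᵥ C *ᵥ α := by simpa using hC.dotProduct_mulVec_pos hα
  have hsymm : ∀ x y : Fin p → ℝ, x ⬝ᵥ C *ᵥ y = y ⬝ᵥ C *ᵥ x := by
    intro x y
    have hT : Cᵀ = C := by
      simpa [Matrix.conjTranspose_eq_transpose_of_trivial] using hC.isHermitian.eq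
    conv_lhs => rw [← hT, dotProduct_transpose_mulVec, dotProduct_comm]
  have hexp : ∀ r : ℝ, (a - r • α) ⬝ᵥ C *ᵥ (a - r • α) =
      a ⬝ᵥ C *ᵥ a - 2 * r * (a ⬝ᵥ C *ᵥ α) + r ^ 2 * (α ⬝ᵥ C *ᵥ α) := by
    intro r
    simp only [Matrix.mulVec_sub, Matrix.mulVec_smul, sub_dotProduct, dotProduct_sub,
      smul_dotProduct, dotProduct_smul, smul_eq_mul, hsymm α a]
    ring
  -- The `C`-orthogonal projection coefficient of `a` on `α`; the defect is the form evaluated at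
  -- the residual.
  set r := (a ⬝ᵥ C *ᵥ α) / (α ⬝ᵥ C *ᵥ α) with hr
  have hD : a ⬝ᵥ C *ᵥ a = (a ⬝ᵥ C *ᵥ α) ^ 2 / (α ⬝ᵥ C *ᵥ α) +
      (a - r • α) ⬝ᵥ C *ᵥ (a - r • α) := by
    rw [hexp r, hr]
    field_simp
    ring
  refine ⟨_, by simpa using hC.posSemidef.dotProduct_mulVec_nonneg (a - r • α), ⟨fun h => ?_, ?_⟩,
    hD⟩
  · refine ⟨r, sub_eq_zero.1 ?_⟩
    by_contra hne
    have := hC.dotProduct_mulVec_pos hne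
    simp only [star_trivial] at this
    exact this.ne' h
  · rintro ⟨k, hk⟩
    have : r = k := by
      rw [hr, hk, smul_dotProduct, smul_eq_mul, mul_div_assoc, div_self hv.ne', mul_one]
    rw [this, hk, sub_self, zero_dotProduct]

/-- Coefficients of the cubic that gives the third central moment of a unit-variance direction. -/
theorem third_moment_eq_cubic {s1 s2 s3 b K t : ℝ} (hs2 : s2 ≠ 0)
    (hV : s2 * K - (s1 * (b * t)) ^ 2 = 1) :
    s3 * (b * (3 * K * t - t ^ 3)) - 3 * (s2 * K) * (s1 * (b * t)) + 2 * (s1 * (b * t)) ^ 3 =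
      (3 * b * (s3 / s2 - s1)) * t +
        (b * (3 * (s3 / s2 - s1) * s1 ^ 2 * b ^ 2 + 2 * s1 ^ 3 * b ^ 2 - s3)) * t ^ 3 := by
  have hK : K = (1 + (s1 * (b * t)) ^ 2) / s2 := by
    rw [eq_div_iff hs2]; linarith
  rw [hK]
  field_simp
  ring

/-- This is the condition of `sq_cubic_lt` with κ replaced by its infimum over `v`, approached as v
→ ∞. The expression collapses to a positive multiple of 2b²s₁s₃ - s₂². -/
theorem cubic_coefficients_nonneg {s1 s2 s3 b : ℝ} (hb : 0 < b) (hs1 : 0 < s1)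
    (hs2 : 0 < s2) (h : s2 ^ 2 ≤ 2 * b ^ 2 * (s1 * s3)) :
    0 ≤ 3 * b * (s3 / s2 - s1) * (s2 - s1 ^ 2 * b ^ 2) +
      3 * (b * (3 * (s3 / s2 - s1) * s1 ^ 2 * b ^ 2 + 2 * s1 ^ 3 * b ^ 2 - s3)) := by
  have : 3 * b * (s3 / s2 - s1) * (s2 - s1 ^ 2 * b ^ 2) +
      3 * (b * (3 * (s3 / s2 - s1) * s1 ^ 2 * b ^ 2 + 2 * s1 ^ 3 * b ^ 2 - s3)) =
      3 * b * s1 / s2 * (2 * b ^ 2 * (s1 * s3) - s2 ^ 2) := by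
    field_simp
    ring
  rw [this]
  exact mul_nonneg (by positivity) (by linarith)

/-! ### The change of scale between `Ω` and its correlation matrix -/

section Scale

variable {p : ℕ} {Ω : Matrix (Fin p) (Fin p) ℝ}

theorem isUnit_det_scale (hΩ : Ω.PosDef) : IsUnit (scale Ω).det := by
  rw [scale, Matrix.det_diagonal, isUnit_iff_ne_zero]
  exact Finset.prod_ne_zero_iff.2 fun i _ => (Real.sqrt_pos.2 hΩ.diag_pos).ne'

theorem scale_mulVec_shape (hΩ : Ω.PosDef) (α : Fin p → ℝ) : scale Ω *ᵥ shape Ω α = α := by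
  rw [shape, Matrix.mulVec_mulVec, Matrix.mul_nonsing_inv _ (isUnit_det_scale hΩ),
    Matrix.one_mulVec]

theorem scale_transpose (Ω : Matrix (Fin p) (Fin p) ℝ) : (scale Ω)ᵀ = scale Ω := by
  rw [scale, Matrix.diagonal_transpose]

theorem posDef_corr (hΩ : Ω.PosDef) : (corr Ω).PosDef := by
  have hu : IsUnit (scale Ω)⁻¹ :=
    (Matrix.isUnit_nonsing_inv_iff).2 ((Matrix.isUnit_iff_isUnit_det _).2 (isUnit_det_scale hΩ))
  have h := (Matrix.IsUnit.posDef_star_left_conjugate_iff hu).2 hΩ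
  rwa [Matrix.star_eq_conjTranspose, Matrix.conjTranspose_eq_transpose_of_trivial,
    Matrix.transpose_nonsing_inv, scale_transpose] at h

theorem eq_smul_shape_iff (hΩ : Ω.PosDef) (α d : Fin p → ℝ) :
    (∃ r : ℝ, d = r • shape Ω α) ↔ ∃ r : ℝ, scale Ω *ᵥ d = r • α := by
  refine exists_congr fun r => ⟨fun h => ?_, fun h => ?_⟩
  · rw [h, Matrix.mulVec_smul, scale_mulVec_shape hΩ]
  · rw [shape, ← Matrix.mulVec_smul, ← h, Matrix.mulVec_mulVec,
      Matrix.nonsing_inv_mul _ (isUnit_det_scale hΩ), Matrix.one_mulVec]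

end Scale

/-! ### Projections of the skew-slash law as scalar scale mixtures -/

/-- The law of the mixing variable `U ^ (-1 / q)`. -/
noncomputable def slashLaw (q : ℝ) : Measure ℝ := uniform01.map fun u => u ^ (-1 / q)

theorem measurable_slash (q : ℝ) : Measurable fun u : ℝ => u ^ (-1 / q) := by fun_prop

theorem isProbabilityMeasure_slashLaw (q : ℝ) : IsProbabilityMeasure (slashLaw q) :=
  have := isProbabilityMeasure_uniform01
  Measure.isProbabilityMeasure_map (measurable_slash q).aemeasurable

theorem integrable_and_integral_pow_slashLaw {q : ℝ} (hq : 0 < q) {m : ℕ} (hm : (m : ℝ) < q) :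
    Integrable (fun s : ℝ => s ^ m) (slashLaw q) ∧ ∫ s, s ^ m ∂(slashLaw q) = q / (q - m) := by
  have hs : AEStronglyMeasurable (fun s : ℝ => s ^ m) (slashLaw q) := by fun_prop
  obtain ⟨h1, h2⟩ := integrable_and_integral_slash_pow hq hm
  exact ⟨(integrable_map_measure hs (measurable_slash q).aemeasurable).2 h1,
    (integral_map (measurable_slash q).aemeasurable hs).trans h2⟩

theorem memLp_three_slashLaw {q : ℝ} (hq : 3 < q) : MemLp (fun s : ℝ => s) 3 (slashLaw q) := by
  have h := (integrable_and_integral_pow_slashLaw (by linarith) (m := 3) (by exact_mod_cast hq)).1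
  refine (integrable_norm_rpow_iff (by fun_prop) (by simp) (by simp)).1 ?_
  refine h.norm.congr (ae_of_all _ fun s => ?_)
  simp [norm_pow]

/-- The location-scale mixture map `(s, z) ↦ ξ + ω s z`. -/
noncomputable def mixtureMap {p : ℕ} (ξ : Fin p → ℝ) (Ω : Matrix (Fin p) (Fin p) ℝ)
    (sz : ℝ × (Fin p → ℝ)) : Fin p → ℝ := ξ + scale Ω *ᵥ (sz.1 • sz.2)

theorem measurable_mixtureMap {p : ℕ} (ξ : Fin p → ℝ) (Ω : Matrix (Fin p) (Fin p) ℝ) :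
    Measurable (mixtureMap ξ Ω) := by
  unfold mixtureMap Matrix.mulVec dotProduct
  refine measurable_pi_lambda _ fun i => ?_
  simp only [Pi.add_apply, Pi.smul_apply, smul_eq_mul]
  fun_prop

theorem dotProduct_mixtureMap {p : ℕ} (ξ : Fin p → ℝ) (Ω : Matrix (Fin p) (Fin p) ℝ)
    (d : Fin p → ℝ) (sz : ℝ × (Fin p → ℝ)) :
    d ⬝ᵥ mixtureMap ξ Ω sz = d ⬝ᵥ ξ + sz.1 * (scale Ω *ᵥ d ⬝ᵥ sz.2) := by
  rw [mixtureMap, dotProduct_add, Matrix.mulVec_smul, dotProduct_smul, smul_eq_mul,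
    ← dotProduct_transpose_mulVec, scale_transpose]

theorem identDistrib_dotProduct_skewSlash {S : Type*} [MeasurableSpace S] {P : Measure S} {q : ℝ}
    {p : ℕ} {ξ : Fin p → ℝ} {Ω : Matrix (Fin p) (Fin p) ℝ} {α : Fin p → ℝ} {X : S → Fin p → ℝ}
    (hX : HasLaw X (skewSlash ξ Ω α q) P) (d : Fin p → ℝ) :
    IdentDistrib (fun s => d ⬝ᵥ X s)
      (fun z : ℝ × (Fin p → ℝ) => d ⬝ᵥ ξ + z.1 * (scale Ω *ᵥ d ⬝ᵥ z.2)) P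
      ((slashLaw q).prod (skewNormal (corr Ω) α)) := by
  have h : IdentDistrib X (mixtureMap ξ Ω) P ((slashLaw q).prod (skewNormal (corr Ω) α)) :=
    ⟨hX.aemeasurable, (measurable_mixtureMap ξ Ω).aemeasurable, hX.map_eq⟩
  have h2 := h.comp (measurable_dotProduct_const_left d)
  simp only [Function.comp_def, dotProduct_mixtureMap] at h2
  exact h2

theorem skewness_scale_mixture_of_variance_eq_one {S T : Type*} [MeasurableSpace S]
    [MeasurableSpace T] {μ : Measure S} {ν : Measure T} [IsProbabilityMeasure μ]
    [IsProbabilityMeasure ν] {f : S → ℝ} {g : T → ℝ} (hf : MemLp f 3 μ) (hg : MemLp g 3 ν) (c : ℝ)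
    (hV : Var[fun z : S × T => c + f z.1 * g z.2; μ.prod ν] = 1) :
    skewness (fun z : S × T => c + f z.1 * g z.2) (μ.prod ν) =
      ((∫ x, f x ^ 3 ∂μ) * (∫ y, g y ^ 3 ∂ν) -
        3 * ((∫ x, f x ^ 2 ∂μ) * ∫ y, g y ^ 2 ∂ν) * ((∫ x, f x ∂μ) * ∫ y, g y ∂ν) +
        2 * ((∫ x, f x ∂μ) * ∫ y, g y ∂ν) ^ 3) ^ 2 := by
  rw [skewness, hV, integral_scale_mixture hf hg, Real.sqrt_one,
    ← integral_central_three_scale_mixture hf hg c]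
  simp only [div_one]

/-- A positive defect uses up variance and leaves t² below its bound 1/κ, while a zero defect
attains it; monotonicity of the squared cubic concludes. A feasible direction of zero defect must
exist, to serve as the competitor that beats all the others. -/
theorem maxSkewnessDirections_eq_of_cubic {S : Type*} [MeasurableSpace S] {p : ℕ}
    {X : S → Fin p → ℝ} {P : Measure S} {A B κ s2 : ℝ} {t D : (Fin p → ℝ) → ℝ}
    (hA : 0 < A) (hκ : 0 < κ) (hs2 : 0 < s2) (hB : 0 ≤ A * κ + 3 * B)
    (hD : ∀ d, 0 ≤ D d)
    (hV : ∀ d, d ⬝ᵥ covMatrix X P *ᵥ d = t d ^ 2 * κ + s2 * D d)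
    (hskew : ∀ d ∈ unitDirections X P,
      skewness (fun s => d ⬝ᵥ X s) P = (A * t d + B * t d ^ 3) ^ 2)
    (hne : ∃ d ∈ unitDirections X P, D d = 0) :
    maxSkewnessDirections X P = {d | d ∈ unitDirections X P ∧ D d = 0} := by
  have hle : ∀ d ∈ unitDirections X P, t d ^ 2 * κ ≤ 1 := by
    intro d hd
    have h1 : d ⬝ᵥ covMatrix X P *ᵥ d = 1 := hd
    rw [hV d] at h1
    nlinarith [mul_nonneg hs2.le (hD d)]
  have heq : ∀ d ∈ unitDirections X P, D d = 0 → t d ^ 2 * κ = 1 := by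
    intro d hd h0
    have h1 : d ⬝ᵥ covMatrix X P *ᵥ d = 1 := hd
    rwa [hV d, h0, mul_zero, add_zero] at h1
  obtain ⟨d0, hd0, hD0⟩ := hne
  ext d
  constructor
  · rintro ⟨hd, hmax⟩
    refine ⟨hd, ?_⟩
    by_contra hne
    have hpos : 0 < D d := lt_of_le_of_ne (hD d) (Ne.symm hne)
    have h1 : d ⬝ᵥ covMatrix X P *ᵥ d = 1 := hd
    rw [hV d] at h1
    have hlt : t d ^ 2 < t d0 ^ 2 := by
      refine lt_of_mul_lt_mul_right ?_ hκ.le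
      rw [heq d0 hd0 hD0]
      nlinarith [mul_pos hs2 hpos]
    have h2 : skewness (fun s => d0 ⬝ᵥ X s) P ≤ skewness (fun s => d ⬝ᵥ X s) P := hmax hd0
    rw [hskew d hd, hskew d0 hd0] at h2
    exact absurd (sq_cubic_lt hA hκ hB (hle d0 hd0) hlt) (not_lt.2 h2)
  · rintro ⟨hd, h0⟩
    refine ⟨hd, fun e he => ?_⟩
    change skewness (fun s => e ⬝ᵥ X s) P ≤ skewness (fun s => d ⬝ᵥ X s) P
    rw [hskew d hd, hskew e he]
    refine sq_cubic_le hA hκ hB (hle d hd) ?_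
    refine le_of_mul_le_mul_right ?_ hκ
    rw [heq d hd h0]
    exact hle e he

theorem variance_eq_defect_form {s1 s2 b r v w D : ℝ} (hv : v ≠ 0) (hw : w ≠ 0)
    (hwv : w ^ 2 = 1 + v) :
    s2 * (r ^ 2 / v + D) - (s1 * (b * (r / w))) ^ 2 =
      (r / w) ^ 2 * (s2 * ((1 + v) / v) - s1 ^ 2 * b ^ 2) + s2 * D := by
  rw [← hwv]
  field_simp
  ring

theorem skewSlash_maxSkewness {S : Type*} [MeasurableSpace S] {P : Measure S}
    [IsProbabilityMeasure P] {q : ℝ} (hq : 3 < q) {p : ℕ} {ξ : Fin p → ℝ}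
    {Ω : Matrix (Fin p) (Fin p) ℝ} (hΩ : Ω.PosDef) {α : Fin p → ℝ} {X : S → Fin p → ℝ}
    (hX : HasLaw X (skewSlash ξ Ω α q) P) :
    (∀ i, MemLp (fun s => X s i) 3 P) ∧
      (α ≠ 0 → 0 < shape Ω α ⬝ᵥ covMatrix X P *ᵥ shape Ω α ∧
        maxSkewnessDirections X P =
          {d | d ∈ unitDirections X P ∧ ∃ r : ℝ, d = r • shape Ω α}) := by
  have hC := posDef_corr hΩ
  have := isProbabilityMeasure_slashLaw q
  have := isProbabilityMeasure_skewNormal hC α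
  have hf := memLp_three_slashLaw hq
  have hg (d : Fin p → ℝ) := memLp_dotProduct_skewNormal hC α (scale Ω *ᵥ d) (k := 3) (by simp)
  have hid := identDistrib_dotProduct_skewSlash hX
  have hmem (d : Fin p → ℝ) : MemLp (fun s => d ⬝ᵥ X s) 3 P :=
    (hid d).memLp_iff.2 (memLp_three_mul_prod hf (hg d) (d ⬝ᵥ ξ))
  have hmemi (i : Fin p) : MemLp (fun s => X s i) 3 P := by
    simpa using hmem (Pi.single i 1)
  refine ⟨hmemi, fun hα => ?_⟩
  have hpi := Real.pi_pos
  have hq1 : 0 < q - 1 := by linarith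
  have hq2 : 0 < q - 2 := by linarith
  have hq3 : 0 < q - 3 := by linarith
  have hq0 : 0 < q := by linarith
  have hm1 := (integrable_and_integral_pow_slashLaw hq0 (m := 1) (by norm_num; linarith)).2
  have hm2 := (integrable_and_integral_pow_slashLaw hq0 (m := 2) (by norm_num; linarith)).2
  have hm3 := (integrable_and_integral_pow_slashLaw hq0 (m := 3) (by norm_num; linarith)).2
  simp only [pow_one, Nat.cast_one, Nat.cast_ofNat] at hm1 hm2 hm3
  obtain ⟨s1, hs1⟩ : ∃ s, s = q / (q - 1) := ⟨_, rfl⟩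
  obtain ⟨s2, hs2⟩ : ∃ s, s = q / (q - 2) := ⟨_, rfl⟩
  obtain ⟨s3, hs3⟩ : ∃ s, s = q / (q - 3) := ⟨_, rfl⟩
  obtain ⟨b, hb⟩ : ∃ b, b = √(2 / Real.pi) := ⟨_, rfl⟩
  have hs1p : 0 < s1 := by rw [hs1]; positivity
  have hs2p : 0 < s2 := by rw [hs2]; positivity
  have hs3p : 0 < s3 := by rw [hs3]; positivity
  have hbp : 0 < b := by rw [hb]; positivity
  have hbsq : b ^ 2 = 2 / Real.pi := by rw [hb, Real.sq_sqrt (by positivity)]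
  have hb1 : b ^ 2 < 1 := by
    rw [hbsq, div_lt_one hpi]; linarith [Real.pi_gt_three]
  have hb2 : 1 ≤ 2 * b ^ 2 := by
    rw [hbsq, ← mul_div_assoc, le_div_iff₀ hpi]; linarith [Real.pi_lt_four]
  have hs12 : s1 ^ 2 ≤ s2 := by
    rw [hs1, hs2, div_pow, div_le_div_iff₀ (by positivity) hq2]
    nlinarith
  -- Cauchy–Schwarz for the moments of `S`; here it amounts to (q-1)(q-3) = (q-2)² - 1 ≤ (q-2)².
  have hs13 : s2 ^ 2 ≤ s1 * s3 := by
    rw [hs1, hs2, hs3, div_pow, div_mul_div_comm, div_le_div_iff₀ (by positivity) (by positivity)]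
    nlinarith [sq_nonneg q]
  have hs123 : s1 < s3 / s2 := by
    rw [lt_div_iff₀ hs2p, hs1, hs2, hs3, div_mul_div_comm,
      div_lt_div_iff₀ (by positivity) hq3]
    nlinarith
  rw [← hs1] at hm1
  rw [← hs2] at hm2
  rw [← hs3] at hm3
  -- From here on only positive definiteness of the correlation matrix matters.
  generalize corr Ω = C at *
  set v := α ⬝ᵥ C *ᵥ α with hv
  have hvp : 0 < v := by simpa using hC.dotProduct_mulVec_pos hα
  have hvs : 0 < √(1 + v) := by positivity
  have hvsq : √(1 + v) ^ 2 = 1 + v := Real.sq_sqrt (by positivity)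
  set t : (Fin p → ℝ) → ℝ := fun d => (scale Ω *ᵥ d) ⬝ᵥ C *ᵥ α / √(1 + v) with ht
  choose D hD0 hDiff hDeq using fun d : Fin p → ℝ =>
    exists_dotProduct_eq_add_defect hC hα (scale Ω *ᵥ d)
  have hmom (d : Fin p → ℝ) := integral_dotProduct_skewNormal hC hα (scale Ω *ᵥ d)
  set A := 3 * b * (s3 / s2 - s1) with hA
  set B := b * (3 * (s3 / s2 - s1) * s1 ^ 2 * b ^ 2 + 2 * s1 ^ 3 * b ^ 2 - s3) with hB
  set κ := s2 * ((1 + v) / v) - s1 ^ 2 * b ^ 2 with hκ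
  have hvv : 1 ≤ (1 + v) / v := by rw [le_div_iff₀ hvp]; linarith
  have hκ0 : s2 - s1 ^ 2 * b ^ 2 ≤ κ := by
    rw [hκ]; nlinarith
  have hκ0p : 0 < s2 - s1 ^ 2 * b ^ 2 := by nlinarith [mul_pos hs1p hs1p]
  have hκp : 0 < κ := hκ0p.trans_le hκ0
  have hAp : 0 < A := by
    rw [hA]; exact mul_pos (by positivity) (sub_pos.2 hs123)
  -- `hb2` and `hs13` give s₂² ≤ 2b²s₁s₃; passing from the smaller constant up to `κ` is harmless
  -- since `A` is positive.
  have hAB : 0 ≤ A * κ + 3 * B := by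
    have h1 := cubic_coefficients_nonneg (s3 := s3) hbp hs1p hs2p (by nlinarith)
    nlinarith [mul_le_mul_of_nonneg_left hκ0 hAp.le]
  have hVar (d : Fin p → ℝ) : Var[fun s => d ⬝ᵥ X s; P] =
      s2 * ((scale Ω *ᵥ d) ⬝ᵥ C *ᵥ (scale Ω *ᵥ d)) - (s1 * (b * t d)) ^ 2 := by
    rw [(hid d).variance_eq, variance_scale_mixture hf (hg d), hm1, hm2, (hmom d).1, (hmom d).2.1,
      ← hb]
  have hcov (d : Fin p → ℝ) : d ⬝ᵥ covMatrix X P *ᵥ d = Var[fun s => d ⬝ᵥ X s; P] :=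
    dotProduct_covMatrix_mulVec (fun i => (hmemi i).mono_exponent (by norm_num)) d
  have hV (d : Fin p → ℝ) : d ⬝ᵥ covMatrix X P *ᵥ d = t d ^ 2 * κ + s2 * D d := by
    rw [hcov, hVar, hDeq]
    exact variance_eq_defect_form hvp.ne' hvs.ne' hvsq
  have hskew (d : Fin p → ℝ) (hd : d ∈ unitDirections X P) :
      skewness (fun s => d ⬝ᵥ X s) P = (A * t d + B * t d ^ 3) ^ 2 := by
    have h1 : Var[fun s => d ⬝ᵥ X s; P] = 1 := (hcov d).symm.trans hd
    have h2 := (hVar d).symm.trans h1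
    rw [(hid d).variance_eq] at h1
    rw [skewness_congr (hid d), skewness_scale_mixture_of_variance_eq_one hf (hg d) _ h1, hm1, hm2, hm3, (hmom d).1, (hmom d).2.1,
      (hmom d).2.2, ← hb]
    exact congrArg (· ^ 2) (third_moment_eq_cubic hs2p.ne' h2)
  have hDη : D (shape Ω α) = 0 := (hDiff _).2 ⟨1, by rw [scale_mulVec_shape hΩ, one_smul]⟩
  have hpos : 0 < shape Ω α ⬝ᵥ covMatrix X P *ᵥ shape Ω α := by
    rw [hV, hDη, mul_zero, add_zero, ht]
    simp only [scale_mulVec_shape hΩ]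
    have : 0 < v / √(1 + v) := by positivity
    positivity
  refine ⟨hpos, ?_⟩
  rw [maxSkewnessDirections_eq_of_cubic hAp hκp hs2p hAB hD0 hV hskew]
  · simp only [hDiff, eq_smul_shape_iff hΩ]
  -- The competitor is η scaled to unit variance.
  · refine ⟨(√(shape Ω α ⬝ᵥ covMatrix X P *ᵥ shape Ω α))⁻¹ • shape Ω α, ?_, ?_⟩
    · change _ ⬝ᵥ covMatrix X P *ᵥ _ = 1
      rw [Matrix.mulVec_smul, smul_dotProduct, dotProduct_smul, smul_eq_mul, smul_eq_mul,
        ← mul_assoc, ← mul_inv, Real.mul_self_sqrt hpos.le, inv_mul_cancel₀ hpos.ne']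
    · exact (hDiff _).2 ⟨_, by rw [Matrix.mulVec_smul, scale_mulVec_shape hΩ]⟩

end SkewSlash

theorem mainTheorem5 {S : Type*} [MeasurableSpace S] (P : Measure S) [IsProbabilityMeasure P]
    (q : ℝ) (hq : 0 < q)
    (U : S → ℝ) (hU : HasLaw U SkewSlash.uniform01 P)
    (M : S → ℝ) (hM : M = fun s => U s ^ (-1 / q))
    (p : ℕ) (ξ : Fin p → ℝ) (Ω : Matrix (Fin p) (Fin p) ℝ) (hΩ : Ω.PosDef) (α : Fin p → ℝ)
    (X : S → Fin p → ℝ) (hX : HasLaw X (SkewSlash.skewSlash ξ Ω α q) P) :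
    (∀ m : ℕ, (m : ℝ) < q →
      Integrable (fun s => M s ^ m) P ∧ ∫ s, M s ^ m ∂P = q / (q - m)) ∧
    (3 < q →
      (∫ s, M s ^ 2 ∂P) / (∫ s, M s ∂P) ^ 2 = (q - 1) ^ 2 / (q * (q - 2)) ∧
      ((∫ s, M s ^ 2 ∂P) / (∫ s, M s ∂P) ^ 2 ≤ 4 / Real.pi ↔
        1 + 2 / √(4 - Real.pi) ≤ q) ∧
      (4 ≤ q → 4 / Real.pi * (∫ s, M s ∂P) ^ 2 ≥ ∫ s, M s ^ 2 ∂P) ∧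
      (∀ i, MemLp (fun s => X s i) 3 P) ∧
      (α ≠ 0 →
        0 < SkewSlash.shape Ω α ⬝ᵥ SkewSlash.covMatrix X P *ᵥ SkewSlash.shape Ω α ∧
        SkewSlash.maxSkewnessDirections X P =
          {d | d ∈ SkewSlash.unitDirections X P ∧ ∃ r : ℝ, d = r • SkewSlash.shape Ω α})) := by
  have hlaw : HasLaw M (SkewSlash.slashLaw q) P := by
    rw [hM]
    exact HasLaw.comp ⟨(SkewSlash.measurable_slash q).aemeasurable, rfl⟩ hU
  have hmom (m : ℕ) (hm : (m : ℝ) < q) :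
      Integrable (fun s => M s ^ m) P ∧ ∫ s, M s ^ m ∂P = q / (q - m) := by
    obtain ⟨h1, h2⟩ := SkewSlash.integrable_and_integral_pow_slashLaw hq hm
    refine ⟨?_, (hlaw.integral_comp h1.1).trans h2⟩
    rw [← hlaw.map_eq] at h1
    exact h1.comp_aemeasurable hlaw.aemeasurable
  refine ⟨hmom, fun h3 => ?_⟩
  have e1 := (hmom 1 (by norm_num; linarith)).2
  have e2 := (hmom 2 (by norm_num; linarith)).2
  simp only [pow_one, Nat.cast_one, Nat.cast_ofNat] at e1 e2
  rw [e1, e2, SkewSlash.slash_ratio h3]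
  exact ⟨rfl, SkewSlash.slash_ratio_le_iff h3, SkewSlash.slash_moment_condition,
    SkewSlash.skewSlash_maxSkewness h3 hΩ hX⟩
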